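/- Let $D\subset\mathbb{R}^d$ be a nonempty bounded convex open set, let $\Gamma_0,\Gamma_1\subset\partial D$ be disjoint Borel sets, $\Gamma_1$ nonempty and $\Gamma_0$ of positive $(d-1)$-dimensional Hausdorff measure. Let $T\colon H^1(D)\to L^2(\partial D)$ be the trace operator, $H^1_{\Gamma_0}(D)=\{u\in H^1(D): Tu|_{\Gamma_0}=0\}$ and $H^{1/2}(\Gamma_1)=T(H^1(D))|_{\Gamma_1}$ with the quotient norm, $H^{-1/2}(\Gamma_1)$ its dual. Let $\kappa\in C^1((0,\infty))$ be bounded and non-decreasing, with $\kappa'$ bounded and Lipschitz and $\kappa(0):=\lim_{s\to0}\kappa(s)>0$. Fix $f\in (H^1_{\Gamma_0}(D))^*$ and $g\in H^{-1/2}(\Gamma_1)$. Let $p_t(x,y)$ be the Neumann heat kernel of $D$ (the heat kernel of reflecting Brownian motion, continuous on $(0,\infty)\times\overline D\times\overline D$). For $\delta>0$ put $c_1(\delta)=\inf_{D\times D}p_\delta$, $c_2(\delta)=\sup_{D\times D}p_\delta$, let $\mathcal D_\delta$ be the set of probability densities $\rho$ on $D$ with $c_1(\delta)\le\rho\le c_2(\delta)$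 a.e., and let $\mathcal D=\bigcup_{\delta>0}\mathcal D_\delta$. For $\rho\in\mathcal D$ let $u_\rho\in H^1_{\Gamma_0}(D)$ be the solution of $$\int_D\kappa(\rho)\nabla u_\rho\cdot\nabla\phi\,dx=\langle f,\phi\rangle+\langle g,T\phi|_{\Gamma_1}\rangle\qquad\text{for all }\phi\in H^1_{\Gamma_0}(D),$$ and put $$J(\rho)=\langle f,u_\rho\rangle+\langle g,Tu_\rho|_{\Gamma_1}\rangle-\frac12\int_D\kappa(\rho)|\nabla u_\rho|^2\,dx .$$ For a Borel probability measure $\mu$ on $\overline D$ let $J_\delta(\mu)=J(\mu p_\delta)$, where $\mu p_\delta(x)=\int_{\overline D}p_\delta(x,y)\,\mu(dy)$. Then: 1. For every $\rho\in\mathcal D$ the solution $u_\rho$ exists and is unique, so that $J(\rho)$ is well defined. 2. If $\delta>0$, $\rho_n\in\mathcal D_\delta$ for all $n$, $\rho\in\mathcal D_\delta$ and $\rho_n\to\rho$ a.e. in $D$, then $\lim_{n\to\infty}J(\rho_n)=J(\rho)$. 3. If for every $\delta>0$ the measure $\mu_\delta$ minimizes $J_\delta$ over the Borel probability measures on $\overline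 D$, then there are $\delta_k>0$ with $\delta_k\to0$ such that $\lim_{k\to\infty}J_{\delta_k}(\mu_{\delta_k})=\inf_{\mathcal D}J$, and this infimum is finite. -/

import Mathlib

open MeasureTheory Set Filter Topology
open scoped ENNReal ContDiff

namespace MassOpt

noncomputable section

/-- The Euclidean space `ℝ^d`. -/
abbrev Euc (d : ℕ) : Type := EuclideanSpace ℝ (Fin d)

/-- `L²(D)`. -/
abbrev L2 {d : ℕ} (D : Set (Euc d)) : Type :=
  Lp ℝ 2 (volume.restrict D)

/-- `L²(D; ℝ^d)`. -/
abbrev L2Vec {d : ℕ} (D : Set (Euc d)) : Type :=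
  Lp (Euc d) 2 (volume.restrict D)

/-- The `(d-1)`-dimensional Hausdorff measure on the boundary of `D`. -/
def surfaceMeasure {d : ℕ} (D : Set (Euc d)) : Measure (Euc d) :=
  (μH[(d : ℝ) - 1]).restrict (frontier D)

/-- `L²(∂D)`. -/
abbrev L2Bdry {d : ℕ} (D : Set (Euc d)) : Type :=
  Lp ℝ 2 (surfaceMeasure D)

/-- `L²(Γ)` for a part `Γ` of the boundary of `D`. -/
abbrev L2Part {d : ℕ} (D Γ : Set (Euc d)) : Type :=
  Lp ℝ 2 ((surfaceMeasure D).restrict Γ)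

/-- Smooth functions with compact support in `D`. -/
structure IsTestFunction {d : ℕ} (D : Set (Euc d)) (φ : Euc d → ℝ) : Prop where
  contDiff : ContDiff ℝ ∞ φ
  hasCompactSupport : HasCompactSupport φ
  tsupport_subset : tsupport φ ⊆ D

/-- `G` is the weak gradient of `u` in `D`. -/
def IsWeakGradient {d : ℕ} (D : Set (Euc d)) (u : L2 D) (G : L2Vec D) : Prop :=
  ∀ φ : Euc d → ℝ, IsTestFunction D φ → ∀ e : Euc d,
    ∫ x in D, u x * fderiv ℝ φ x e = - ∫ x in D, inner ℝ (G x) e * φ x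

theorem IsTestFunction.memLp_fderiv {d : ℕ} {D : Set (Euc d)} {φ : Euc d → ℝ}
    (h : IsTestFunction D φ) (e : Euc d) :
    MemLp (fun x => fderiv ℝ φ x e) 2 (volume.restrict D) := by
  have hc : Continuous fun x => fderiv ℝ φ x e :=
    (h.contDiff.continuous_fderiv (by simp)).clm_apply continuous_const
  exact (hc.memLp_of_hasCompactSupport (h.hasCompactSupport.fderiv_apply (𝕜 := ℝ) e)).restrict D

theorem IsTestFunction.memLp {d : ℕ} {D : Set (Euc d)} {φ : Euc d → ℝ}
    (h : IsTestFunction D φ) : MemLp φ 2 (volume.restrict D) :=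
  (h.contDiff.continuous.memLp_of_hasCompactSupport h.hasCompactSupport).restrict D

theorem IsTestFunction.integrable_left {d : ℕ} {D : Set (Euc d)} {φ : Euc d → ℝ}
    (h : IsTestFunction D φ) (u : L2 D) (e : Euc d) :
    Integrable (fun x => u x * fderiv ℝ φ x e) (volume.restrict D) :=
  (Lp.memLp u).integrable_mul (h.memLp_fderiv e)

theorem IsTestFunction.integrable_right {d : ℕ} {D : Set (Euc d)} {φ : Euc d → ℝ}
    (h : IsTestFunction D φ) (G : L2Vec D) (e : Euc d) :
    Integrable (fun x => inner ℝ (G x) e * φ x) (volume.restrict D) :=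
  ((Lp.memLp G).inner_const e).integrable_mul h.memLp

/-- The Sobolev space `H¹(D)`: the pairs `(u, ∇u)` in `L²(D) × L²(D; ℝ^d)` in which the second
entry is the weak gradient of the first, with the norm `(‖u‖² + ‖∇u‖²)^{1/2}`. -/
def H1 {d : ℕ} (D : Set (Euc d)) : Submodule ℝ (WithLp 2 (L2 D × L2Vec D)) where
  carrier := {w | IsWeakGradient D w.fst w.snd}
  zero_mem' := by
    intro φ hφ e
    have h1 : (fun x => ((0 : WithLp 2 (L2 D × L2Vec D)).fst : Euc d → ℝ) x * fderiv ℝ φ x e)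
        =ᵐ[volume.restrict D] 0 := by
      filter_upwards [Lp.coeFn_zero ℝ 2 (volume.restrict D)] with x hx
      rw [WithLp.zero_fst, hx]
      simp
    have h2 : (fun x => inner ℝ (((0 : WithLp 2 (L2 D × L2Vec D)).snd : Euc d → Euc d) x) e * φ x)
        =ᵐ[volume.restrict D] 0 := by
      filter_upwards [Lp.coeFn_zero (Euc d) 2 (volume.restrict D)] with x hx
      rw [WithLp.zero_snd, hx]
      simp
    rw [integral_congr_ae h1, integral_congr_ae h2]
    simp
  add_mem' := by
    intro a b ha hb φ hφ e
    have h1 : (fun x => ((a + b).fst : Euc d → ℝ) x * fderiv ℝ φ x e)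
        =ᵐ[volume.restrict D]
        fun x => (a.fst : Euc d → ℝ) x * fderiv ℝ φ x e + b.fst x * fderiv ℝ φ x e := by
      filter_upwards [Lp.coeFn_add a.fst b.fst] with x hx
      rw [WithLp.add_fst, hx, Pi.add_apply, add_mul]
    have h2 : (fun x => inner ℝ (((a + b).snd : Euc d → Euc d) x) e * φ x)
        =ᵐ[volume.restrict D]
        fun x => inner ℝ ((a.snd : Euc d → Euc d) x) e * φ x + inner ℝ (b.snd x) e * φ x := by
      filter_upwards [Lp.coeFn_add a.snd b.snd] with x hx
      rw [WithLp.add_snd, hx, Pi.add_apply, inner_add_left, add_mul]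
    rw [integral_congr_ae h1, integral_congr_ae h2,
      integral_add (hφ.integrable_left _ e) (hφ.integrable_left _ e),
      integral_add (hφ.integrable_right _ e) (hφ.integrable_right _ e), ha φ hφ e, hb φ hφ e]
    ring
  smul_mem' := by
    intro c a ha φ hφ e
    have h1 : (fun x => ((c • a).fst : Euc d → ℝ) x * fderiv ℝ φ x e)
        =ᵐ[volume.restrict D]
        fun x => c * ((a.fst : Euc d → ℝ) x * fderiv ℝ φ x e) := by
      filter_upwards [Lp.coeFn_smul c a.fst] with x hx
      rw [WithLp.smul_fst, hx, Pi.smul_apply, smul_eq_mul, mul_assoc]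
    have h2 : (fun x => inner ℝ (((c • a).snd : Euc d → Euc d) x) e * φ x)
        =ᵐ[volume.restrict D]
        fun x => c * (inner ℝ ((a.snd : Euc d → Euc d) x) e * φ x) := by
      filter_upwards [Lp.coeFn_smul c a.snd] with x hx
      rw [WithLp.smul_snd, hx, Pi.smul_apply, real_inner_smul_left, mul_assoc]
    rw [integral_congr_ae h1, integral_congr_ae h2, integral_const_mul, integral_const_mul,
      ha φ hφ e]
    ring

/-- The function underlying an element of `H¹(D)`. -/
def H1.fn {d : ℕ} {D : Set (Euc d)} (w : H1 D) : L2 D := w.1.fst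

/-- The weak gradient of an element of `H¹(D)`. -/
def H1.grad {d : ℕ} {D : Set (Euc d)} (w : H1 D) : L2Vec D := w.1.snd

/-- The pairs `(φ|_D, φ|_{∂D})` with `φ` smooth on `ℝ^d`. -/
def smoothTraceGraph {d : ℕ} (D : Set (Euc d)) : Submodule ℝ (H1 D × L2Bdry D) where
  carrier := {z | ∃ φ : Euc d → ℝ, ContDiff ℝ ∞ φ ∧
    H1.fn z.1 =ᵐ[volume.restrict D] φ ∧
    H1.grad z.1 =ᵐ[volume.restrict D] (fun x => gradient φ x) ∧
    z.2 =ᵐ[surfaceMeasure D] φ}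
  zero_mem' := by
    refine ⟨0, contDiff_const, Lp.coeFn_zero _ _ _, ?_, Lp.coeFn_zero _ _ _⟩
    filter_upwards [Lp.coeFn_zero (Euc d) 2 (volume.restrict D)] with x hx
    have h0 : gradient (0 : Euc d → ℝ) x = 0 := gradient_fun_const x 0
    rw [h0]
    exact hx
  add_mem' := by
    rintro a b ⟨φ, hφ, h1, h2, h3⟩ ⟨ψ, hψ, k1, k2, k3⟩
    refine ⟨φ + ψ, hφ.add hψ, ?_, ?_, ?_⟩
    · exact (Lp.coeFn_add (H1.fn a.1) (H1.fn b.1)).trans (h1.add k1)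
    · refine (Lp.coeFn_add (H1.grad a.1) (H1.grad b.1)).trans ((h2.add k2).trans ?_)
      filter_upwards with x
      simp only [gradient, Pi.add_apply]
      rw [fderiv_add (hφ.differentiable (by simp) x) (hψ.differentiable (by simp) x), map_add]
    · exact (Lp.coeFn_add a.2 b.2).trans (h3.add k3)
  smul_mem' := by
    rintro c a ⟨φ, hφ, h1, h2, h3⟩
    refine ⟨c • φ, hφ.const_smul c, ?_, ?_, ?_⟩
    · exact (Lp.coeFn_smul c (H1.fn a.1)).trans (h1.const_smul c)
    · refine (Lp.coeFn_smul c (H1.grad a.1)).trans ((h2.const_smul c).trans ?_)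
      filter_upwards with x
      simp only [gradient, Pi.smul_apply]
      rw [fderiv_const_smul (hφ.differentiable (by simp) x), map_smul]
    · exact (Lp.coeFn_smul c a.2).trans (h3.const_smul c)

/-- The graph of the trace operator `T : H¹(D) → L²(∂D)`: the closure, in `H¹(D) × L²(∂D)`, of the
restriction `φ|_D ↦ φ|_{∂D}` on smooth functions. -/
def traceGraph {d : ℕ} (D : Set (Euc d)) : Submodule ℝ (H1 D × L2Bdry D) :=
  (smoothTraceGraph D).topologicalClosure

open Classical in
/-- The trace `T w ∈ L²(∂D)` of `w ∈ H¹(D)`. -/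
def trace {d : ℕ} {D : Set (Euc d)} (w : H1 D) : L2Bdry D :=
  if h : ∃ v : L2Bdry D, (w, v) ∈ traceGraph D then h.choose else 0

/-- Restriction `L²(∂D) → L²(Γ)`. -/
def restrictTo {d : ℕ} (D Γ : Set (Euc d)) : L2Bdry D →ₗ[ℝ] L2Part D Γ :=
  (LpToLpRestrictCLM (Euc d) ℝ ℝ (surfaceMeasure D) 2 Γ).toLinearMap

/-- `H¹_{Γ₀}(D)`: the elements of `H¹(D)` whose trace vanishes on `Γ₀`. -/
def H1Zero {d : ℕ} (D Γ₀ : Set (Euc d)) : Submodule ℝ (H1 D) :=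
  (traceGraph D ⊓ (LinearMap.ker (restrictTo D Γ₀)).comap
    (LinearMap.snd ℝ (H1 D) (L2Bdry D))).map (LinearMap.fst ℝ (H1 D) (L2Bdry D))

/-- `H^{1/2}(Γ₁) = T(H¹(D))|_{Γ₁}`, a subspace of `L²(Γ₁)`. -/
def HHalf {d : ℕ} (D Γ₁ : Set (Euc d)) : Submodule ℝ (L2Part D Γ₁) :=
  (traceGraph D).map (restrictTo D Γ₁ ∘ₗ LinearMap.snd ℝ (H1 D) (L2Bdry D))

/-- Membership of a linear functional on `H^{1/2}(Γ₁)` in the dual space `H^{-1/2}(Γ₁)`: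
continuity for the norm `‖b‖ = inf {‖w‖_{H¹(D)} : (T w)|_{Γ₁} = b}`. -/
def IsHNegHalf {d : ℕ} {D Γ₁ : Set (Euc d)} (g : HHalf D Γ₁ →ₗ[ℝ] ℝ) : Prop :=
  ∃ C : ℝ, ∀ (b : HHalf D Γ₁) (w : H1 D) (v : L2Bdry D),
    (w, v) ∈ traceGraph D → restrictTo D Γ₁ v = (b : L2Part D Γ₁) → |g b| ≤ C * ‖w‖

theorem restrict_trace_mem {d : ℕ} {D : Set (Euc d)} (Γ₁ : Set (Euc d)) (w : H1 D) :
    restrictTo D Γ₁ (trace w) ∈ HHalf D Γ₁ := by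
  unfold trace
  split_ifs with h
  · exact ⟨(w, h.choose), h.choose_spec, rfl⟩
  · rw [map_zero]
    exact Submodule.zero_mem _

/-- `(T w)|_{Γ₁}` as an element of `H^{1/2}(Γ₁)`. -/
def traceOn {d : ℕ} {D : Set (Euc d)} (Γ₁ : Set (Euc d)) (w : H1 D) : HHalf D Γ₁ :=
  ⟨restrictTo D Γ₁ (trace w), restrict_trace_mem Γ₁ w⟩

/-- The standing assumptions on the conductivity law `κ ∈ C¹((0, ∞))`. The real function `κ` is
only used on `[0, ∞)`, and `κ 0` stands for the limit of `κ` at `0`. -/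
structure IsConductivity (κ : ℝ → ℝ) : Prop where
  contDiffOn : ContDiffOn ℝ 1 κ (Ioi 0)
  monotoneOn : MonotoneOn κ (Ioi 0)
  bounded : ∃ C, ∀ s ∈ Ioi (0 : ℝ), |κ s| ≤ C
  deriv_bounded : ∃ C, ∀ s ∈ Ioi (0 : ℝ), |deriv κ s| ≤ C
  deriv_lipschitz : ∃ K, LipschitzOnWith K (deriv κ) (Ioi 0)
  tendsto_zero : Tendsto κ (𝓝[>] 0) (𝓝 (κ 0))
  pos_zero : 0 < κ 0

/-- `p` is the Neumann heat kernel of `D`, i.e. the heat kernel of reflecting Brownian motion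
(generator `Δ/2` with Neumann boundary condition): the jointly continuous symmetric transition
probability density on the closure of `D` for which `U t = ∫_D p t · y h(y) dy` is, for every
`h ∈ L²(D)`, the solution of `∂ₜ U = Δ U / 2` with Neumann boundary condition (in weak form) and
initial value `h`. -/
structure IsNeumannHeatKernel {d : ℕ} (D : Set (Euc d)) (p : ℝ → Euc d → Euc d → ℝ) : Prop where
  continuousOn : ContinuousOn (fun z : ℝ × Euc d × Euc d => p z.1 z.2.1 z.2.2)
    (Ioi 0 ×ˢ closure D ×ˢ closure D)
  nonneg : ∀ t > 0, ∀ x ∈ closure D, ∀ y ∈ closure D, 0 ≤ p t x y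
  symm : ∀ t > 0, ∀ x ∈ closure D, ∀ y ∈ closure D, p t x y = p t y x
  mass_one : ∀ t > 0, ∀ x ∈ closure D, ∫ y in D, p t x y = 1
  heat_eq : ∀ h : L2 D, ∃ U : ℝ → L2 D,
    (∀ t > 0, U t =ᵐ[volume.restrict D] fun x => ∫ y in D, p t x y * h y) ∧
    Tendsto U (𝓝[>] 0) (𝓝 h) ∧
    ∀ t > 0, ∃ (w : H1 D) (V : L2 D), H1.fn w = U t ∧ HasDerivAt U V t ∧
      ∀ φ : H1 D, inner ℝ V (H1.fn φ) = -(1 / 2) * inner ℝ (H1.grad w) (H1.grad φ)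

/-- `c₁(δ) = inf_{D × D} p_δ`. -/
def kernelInf {d : ℕ} (D : Set (Euc d)) (p : ℝ → Euc d → Euc d → ℝ) (δ : ℝ) : ℝ :=
  sInf ((fun z : Euc d × Euc d => p δ z.1 z.2) '' (D ×ˢ D))

/-- `c₂(δ) = sup_{D × D} p_δ`. -/
def kernelSup {d : ℕ} (D : Set (Euc d)) (p : ℝ → Euc d → Euc d → ℝ) (δ : ℝ) : ℝ :=
  sSup ((fun z : Euc d × Euc d => p δ z.1 z.2) '' (D ×ˢ D))

/-- The class `𝒟_δ` of the probability densities on `D` with values in `[c₁(δ), c₂(δ)]`. -/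
def densityClass {d : ℕ} (D : Set (Euc d)) (p : ℝ → Euc d → Euc d → ℝ) (δ : ℝ) :
    Set (Euc d → ℝ) :=
  {ρ | AEMeasurable ρ (volume.restrict D) ∧
    (∀ᵐ x ∂volume.restrict D, 0 ≤ ρ x) ∧
    ∫⁻ x in D, ENNReal.ofReal (ρ x) = 1 ∧
    ∀ᵐ x ∂volume.restrict D, kernelInf D p δ ≤ ρ x ∧ ρ x ≤ kernelSup D p δ}

/-- `𝒟 = ⋃_{δ > 0} 𝒟_δ`. -/
def allDensities {d : ℕ} (D : Set (Euc d)) (p : ℝ → Euc d → Euc d → ℝ) : Set (Euc d → ℝ) :=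
  {ρ | ∃ δ > 0, ρ ∈ densityClass D p δ}

/-- The Borel probability measures on the closure of `D`. -/
def probMeasures {d : ℕ} (D : Set (Euc d)) : Set (Measure (Euc d)) :=
  {μ | IsProbabilityMeasure μ ∧ μ (closure D)ᶜ = 0}

/-- The density of `μ p_δ`. -/
def heatDensity {d : ℕ} (p : ℝ → Euc d → Euc d → ℝ) (δ : ℝ) (μ : Measure (Euc d)) :
    Euc d → ℝ :=
  fun x => ∫ y, p δ x y ∂μ

/-- The weak form of the heat conduction problem
`∫_D κ(ρ) ∇u · ∇φ = ⟨f, φ⟩ + ⟨g, (T φ)|_{Γ₁}⟩` for all `φ ∈ H¹_{Γ₀}(D)`. -/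
def IsWeakSolution {d : ℕ} {D Γ₀ Γ₁ : Set (Euc d)} (κ : ℝ → ℝ)
    (f : H1Zero D Γ₀ →L[ℝ] ℝ) (g : HHalf D Γ₁ →ₗ[ℝ] ℝ) (ρ : Euc d → ℝ)
    (u : H1Zero D Γ₀) : Prop :=
  ∀ φ : H1Zero D Γ₀,
    ∫ x in D, κ (ρ x) * inner ℝ (H1.grad u.1 x) (H1.grad φ.1 x) = f φ + g (traceOn Γ₁ φ.1)

open Classical in
/-- The solution `u_ρ` of the heat conduction problem. -/
def solution {d : ℕ} {D Γ₀ Γ₁ : Set (Euc d)} (κ : ℝ → ℝ)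
    (f : H1Zero D Γ₀ →L[ℝ] ℝ) (g : HHalf D Γ₁ →ₗ[ℝ] ℝ) (ρ : Euc d → ℝ) : H1Zero D Γ₀ :=
  if h : ∃ u : H1Zero D Γ₀, IsWeakSolution κ f g ρ u then h.choose else 0

/-- The functional `J(ρ) = ⟨f, u_ρ⟩ + ⟨g, (T u_ρ)|_{Γ₁}⟩ - (1/2) ∫_D κ(ρ) |∇u_ρ|²`. -/
def compliance {d : ℕ} {D Γ₀ Γ₁ : Set (Euc d)} (κ : ℝ → ℝ)
    (f : H1Zero D Γ₀ →L[ℝ] ℝ) (g : HHalf D Γ₁ →ₗ[ℝ] ℝ) (ρ : Euc d → ℝ) : ℝ :=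
  f (solution κ f g ρ) + g (traceOn Γ₁ (solution κ f g ρ).1)
    - 1 / 2 * ∫ x in D, κ (ρ x) * ‖H1.grad (solution κ f g ρ).1 x‖ ^ 2

/-- The relaxed functional `J_δ(μ) = J(μ p_δ)`. -/
def relaxedCompliance {d : ℕ} {D Γ₀ Γ₁ : Set (Euc d)} (p : ℝ → Euc d → Euc d → ℝ) (κ : ℝ → ℝ)
    (f : H1Zero D Γ₀ →L[ℝ] ℝ) (g : HHalf D Γ₁ →ₗ[ℝ] ℝ) (δ : ℝ) (μ : Measure (Euc d)) : ℝ :=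
  compliance κ f g (heatDensity p δ μ)

end

end MassOpt

/-!
The proof has an analytic half, which makes the weak problem well posed on a convex domain, and a
variational half, which passes to the limit in the compliance functional.

**Well-posedness.** Rays from a point `c ∈ D` give a radial projection onto `∂D`, defined by the
Minkowski gauge of `D`. Around each point of an `ε`-separated subset of `∂D`, the part of `D`
between `∂D` and its homothetic image of ratio `1/4` contains about `1/ε` disjoint balls of radius
comparable to `ε` that project close to that point. Comparing this packing with a covering shows
that the `(d-1)`-dimensional Hausdorff measure on `∂D` is at most a multiple of the image of
Lebesgue measure under the projection (`exists_surfaceMeasure_le`). A boundary value of a smooth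
function `φ` can therefore be compared with interior values along rays, and interior values with
each other along segments, so that `∫_D ∫_∂D |φ(x) - φ(y)|²` is at most a multiple of `∫_D |∇φ|²`
(`exists_lintegral_interior_boundary_le`). This single estimate gives the trace inequality and the
Poincaré inequality, and both pass from smooth functions to the graph of the trace, which is the
closure of their graph. So the trace is unique, `H¹_{Γ₀}(D)` is closed, and on it the gradient
controls the full norm (`exists_norm_le_norm_grad`): if the trace vanishes on `Γ₀`, one averages
over `y ∈ Γ₀`, which has positive surface measure. Since `κ ∘ ρ` lies between two positive
constants, Lax–Milgram (`existsUnique_isWeakSolution`) yields the solution `u_ρ`.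

**Passing to the limit.** Testing the equation with `u_ρ` shows that `J(ρ)` is one half of the load
at `u_ρ`, hence nonnegative (`compliance_eq_half_load`, `compliance_nonneg`). When `ρₙ → ρ` almost
everywhere, the difference of the loads of `u_{ρₙ}` and `u_ρ` is `∫ (κ(ρ) - κ(ρₙ)) ∇u_ρ · ∇u_{ρₙ}`;
here `∇u_{ρₙ}` is bounded in `L²`, and `(κ(ρ) - κ(ρₙ)) ∇u_ρ → 0` in `L²` by dominated convergence
(`tendsto_compliance`).

**Approximating the infimum.** The kernel bounds show that the heat flow of any probability measure
for time `δ` lies in `𝒟_δ` (`heatDensity_mem_densityClass`), so `J_δ(μ_δ) ≥ inf J`. Conversely, for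
`ρ ∈ 𝒟` the heat semigroup is `L²`-continuous at time `0`, hence `ρ p_t → ρ` almost everywhere along
a sequence of times (`exists_seq_heatDensity_tendsto`), and `J_t(μ_t) ≤ J(ρ p_t) → J(ρ)`. Choosing
`ρ` nearly optimal gives times at which `J_t(μ_t)` is arbitrarily close to the infimum.
-/

namespace MassOpt

/-! ### Radial projection onto the boundary of a convex set -/

/-- The Minkowski gauge of `D` seen from the centre `c`. -/
noncomputable def radialGauge {d : ℕ} (D : Set (Euc d)) (c x : Euc d) : ℝ :=
  gauge ((fun y => c + y) ⁻¹' D) (x - c)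

/-- The projection along rays from the centre `c` onto the boundary of `D`; it sends `c` to `c`. -/
noncomputable def radialProj {d : ℕ} (D : Set (Euc d)) (c x : Euc d) : Euc d :=
  c + (radialGauge D c x)⁻¹ • (x - c)

/-- The part of `D` that lies strictly between the boundary and its homothetic image of ratio `1/4`
with centre `c`. -/
def shell {d : ℕ} (D : Set (Euc d)) (c : Euc d) : Set (Euc d) :=
  {x | 1 / 4 < radialGauge D c x ∧ radialGauge D c x < 1}

section Gauge

variable {d : ℕ} {D : Set (Euc d)} {c : Euc d}

theorem convex_preimage_add (hDc : Convex ℝ D) : Convex ℝ ((fun y => c + y) ⁻¹' D) :=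
  hDc.translate_preimage_right c

theorem preimage_add_mem_nhds (hDo : IsOpen D) (hc : c ∈ D) :
    (fun y => c + y) ⁻¹' D ∈ 𝓝 (0 : Euc d) := by
  refine (hDo.preimage (by fun_prop)).mem_nhds ?_
  simpa using hc

theorem radialGauge_lt_one_iff (hDo : IsOpen D) (hDc : Convex ℝ D) (hc : c ∈ D) (x : Euc d) :
    radialGauge D c x < 1 ↔ x ∈ D := by
  unfold radialGauge
  rw [gauge_lt_one_iff_mem_interior (convex_preimage_add hDc) (preimage_add_mem_nhds hDo hc),
    (hDo.preimage (by fun_prop)).interior_eq]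
  simp

theorem radialGauge_eq_one_iff (hDo : IsOpen D) (hDc : Convex ℝ D) (hc : c ∈ D) (x : Euc d) :
    radialGauge D c x = 1 ↔ x ∈ frontier D := by
  unfold radialGauge
  rw [gauge_eq_one_iff_mem_frontier (convex_preimage_add hDc) (preimage_add_mem_nhds hDo hc)]
  have h := (Homeomorph.addLeft c).preimage_frontier D
  simp only [Homeomorph.coe_addLeft] at h
  rw [← h]
  simp

theorem radialGauge_dilate {s : ℝ} (hs : 0 ≤ s) (x : Euc d) :
    radialGauge D c (c + s • (x - c)) = s * radialGauge D c x := by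
  unfold radialGauge
  rw [add_sub_cancel_left, gauge_smul_of_nonneg hs, smul_eq_mul]

theorem exists_lipschitzWith_radialGauge (hDo : IsOpen D) (hDc : Convex ℝ D) (hc : c ∈ D) :
    ∃ L, LipschitzWith L (radialGauge D c) := by
  obtain ⟨L, hL⟩ := (convex_preimage_add hDc).lipschitz_gauge (preimage_add_mem_nhds hDo hc)
  refine ⟨L, LipschitzWith.of_dist_le_mul fun x y => ?_⟩
  simpa [radialGauge] using hL.dist_le_mul (x - c) (y - c)

theorem continuous_radialGauge (hDo : IsOpen D) (hDc : Convex ℝ D) (hc : c ∈ D) :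
    Continuous (radialGauge D c) :=
  (exists_lipschitzWith_radialGauge hDo hDc hc).choose_spec.continuous

theorem measurable_radialProj (hDo : IsOpen D) (hDc : Convex ℝ D) (hc : c ∈ D) :
    Measurable (radialProj D c) := by
  have h := (continuous_radialGauge hDo hDc hc).measurable
  unfold radialProj
  fun_prop

theorem isOpen_shell (hDo : IsOpen D) (hDc : Convex ℝ D) (hc : c ∈ D) : IsOpen (shell D c) :=
  (isOpen_lt continuous_const (continuous_radialGauge hDo hDc hc)).inter
    (isOpen_lt (continuous_radialGauge hDo hDc hc) continuous_const)

theorem shell_subset (hDo : IsOpen D) (hDc : Convex ℝ D) (hc : c ∈ D) : shell D c ⊆ D :=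
  fun x hx => (radialGauge_lt_one_iff hDo hDc hc x).1 hx.2

/-- Points near the segment from `c + (a - c) / 2` to `c + 3 (a - c) / 4` lie in the shell and are
projected to points near the boundary point `a`. -/
theorem dist_radialProj_le (hDo : IsOpen D) (hDc : Convex ℝ D) (hc : c ∈ D) {L : NNReal}
    (hL : LipschitzWith L (radialGauge D c)) {R η s : ℝ} {a y : Euc d} (ha : a ∈ frontier D)
    (haR : ‖a - c‖ ≤ R) (hLη : L * η < 1 / 4) (hs : s ∈ Icc (1 / 2 : ℝ) (3 / 4))
    (hy : dist y (c + s • (a - c)) ≤ η) :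
    y ∈ shell D c ∧ dist (radialProj D c y) a ≤ 4 * (L * R + 1) * η := by
  have hη : 0 ≤ η := dist_nonneg.trans hy
  have hg : |radialGauge D c y - s| ≤ L * η := by
    have h1 := hL.dist_le_mul y (c + s • (a - c))
    rw [radialGauge_dilate (by linarith [hs.1]), (radialGauge_eq_one_iff hDo hDc hc a).2 ha,
      mul_one, Real.dist_eq] at h1
    exact h1.trans (by gcongr)
  have hg' := abs_le.1 hg
  have hlow : 1 / 4 < radialGauge D c y := by linarith [hs.1]
  refine ⟨⟨hlow, by linarith [hs.2]⟩, ?_⟩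
  set γ := radialGauge D c y with hγ
  have hγ0 : 0 < γ := by linarith
  have e1 : radialProj D c y - a = γ⁻¹ • ((y - (c + s • (a - c))) + (s - γ) • (a - c)) := by
    have : (γ⁻¹ * γ) • (a - c) = a - c := by rw [inv_mul_cancel₀ hγ0.ne', one_smul]
    unfold radialProj
    rw [← hγ]
    calc c + γ⁻¹ • (y - c) - a = γ⁻¹ • (y - c) - (a - c) := by abel
      _ = γ⁻¹ • (y - c) - (γ⁻¹ * γ) • (a - c) := by rw [this]
      _ = _ := by rw [mul_smul, ← smul_sub]; congr 1; module
  rw [dist_eq_norm, e1, norm_smul]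
  have h2 : ‖(y - (c + s • (a - c))) + (s - γ) • (a - c)‖ ≤ η + L * η * R := by
    refine (norm_add_le _ _).trans (add_le_add (by rwa [← dist_eq_norm]) ?_)
    rw [norm_smul, Real.norm_eq_abs, abs_sub_comm]
    gcongr
  have h3 : ‖γ⁻¹‖ ≤ 4 := by
    rw [norm_inv, Real.norm_of_nonneg hγ0.le]
    calc γ⁻¹ ≤ (1 / 4)⁻¹ := by gcongr
      _ = 4 := by norm_num
  calc ‖γ⁻¹‖ * _ ≤ 4 * (η + L * η * R) := by gcongr
    _ = _ := by ring

/-! ### The surface measure is dominated by the projected volume -/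

theorem segment_param_mem_Icc {r η : ℝ} (hr : 0 < r) (hη : 0 < η) {j : ℕ}
    (hj : j < ⌊r / (8 * η)⌋₊ + 1) : 1 / 2 + j * (2 * η / r) ∈ Icc (1 / 2 : ℝ) (3 / 4) := by
  have h1 : (j : ℝ) ≤ r / (8 * η) :=
    (Nat.cast_le.2 (Nat.lt_succ_iff.1 hj)).trans (Nat.floor_le (by positivity))
  have h2 : (j : ℝ) * (2 * η / r) ≤ r / (8 * η) * (2 * η / r) := by gcongr
  have h3 : r / (8 * η) * (2 * η / r) = 1 / 4 := by field_simp; norm_num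
  have h4 : 0 ≤ (j : ℝ) * (2 * η / r) := by positivity
  constructor <;> linarith

theorem disjoint_balls_on_ray {r η : ℝ} (hr : 0 < r) (hη : 0 < η) {a : Euc d}
    (hra : r ≤ ‖a - c‖) {j k : ℕ} (hjk : j ≠ k) :
    Disjoint (Metric.ball (c + (1 / 2 + j * (2 * η / r) : ℝ) • (a - c)) η)
      (Metric.ball (c + (1 / 2 + k * (2 * η / r) : ℝ) • (a - c)) η) := by
  refine Metric.ball_disjoint_ball ?_
  have h3 : c + (1 / 2 + j * (2 * η / r) : ℝ) • (a - c)
      - (c + (1 / 2 + k * (2 * η / r) : ℝ) • (a - c)) =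
      ((((j : ℤ) - k : ℤ) : ℝ) * (2 * η / r)) • (a - c) := by
    push_cast
    module
  have h4 : (1 : ℝ) ≤ |(((j : ℤ) - k : ℤ) : ℝ)| := by
    rw [← Int.cast_abs]
    exact_mod_cast Int.one_le_abs (sub_ne_zero.2 (Nat.cast_injective.ne hjk))
  rw [dist_eq_norm, h3, norm_smul, norm_mul, Real.norm_eq_abs,
    Real.norm_of_nonneg (show 0 ≤ 2 * η / r by positivity)]
  calc η + η = 1 * (2 * η / r) * r := by field_simp; ring
    _ ≤ _ := by gcongr

theorem sum_volume_ball {ι : Type*} (I : Finset ι) (z : ι → Euc d) {η : ℝ} (hη : 0 < η) :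
    ∑ q ∈ I, volume (Metric.ball (z q) η) =
      ENNReal.ofReal (I.card * η ^ d) * volume (Metric.ball (0 : Euc d) 1) := by
  have : ∀ q ∈ I, volume (Metric.ball (z q) η) =
      ENNReal.ofReal (η ^ d) * volume (Metric.ball (0 : Euc d) 1) := by
    intro q _
    rw [Measure.addHaar_ball_of_pos _ _ hη, finrank_euclideanSpace_fin]
  rw [Finset.sum_congr rfl this, Finset.sum_const, nsmul_eq_mul, ← mul_assoc,
    ENNReal.ofReal_mul (Nat.cast_nonneg _), ENNReal.ofReal_natCast]

/-- A packing estimate: around each point of a separated subset of the boundary, the shell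
contains about `r / η` disjoint balls of radius `η` placed along a ray, all of which project close
to that point. -/
theorem card_mul_volume_ball_le (hDo : IsOpen D) (hDc : Convex ℝ D) (hc : c ∈ D) {L : NNReal}
    (hL : LipschitzWith L (radialGauge D c)) {R r η ε : ℝ} (hr : 0 < r) (hη : 0 < η)
    (hLη : L * η < 1 / 4) (hR : ∀ a ∈ frontier D, ‖a - c‖ ≤ R)
    (hra : ∀ a ∈ frontier D, r ≤ ‖a - c‖) (hε : 4 * (L * R + 1) * η ≤ ε)
    (A : Set (Euc d)) (N : Finset (Euc d)) (hNA : ↑N ⊆ A) (hND : ↑N ⊆ frontier D)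
    (hN : ∀ a ∈ N, ∀ b ∈ N, a ≠ b → 2 * ε < dist a b) :
    ENNReal.ofReal (N.card * (r / (8 * η)) * η ^ d) * volume (Metric.ball (0 : Euc d) 1) ≤
      volume (shell D c ∩ radialProj D c ⁻¹' Metric.cthickening ε A) := by
  obtain ⟨m, hm⟩ : ∃ m : ℕ, m = ⌊r / (8 * η)⌋₊ + 1 := ⟨_, rfl⟩
  obtain ⟨z, hz⟩ : ∃ z : Euc d × ℕ → Euc d,
    ∀ q, z q = c + (1 / 2 + q.2 * (2 * η / r) : ℝ) • (q.1 - c) := ⟨_, fun _ => rfl⟩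
  have key : ∀ q ∈ N ×ˢ Finset.range m, ∀ y ∈ Metric.ball (z q) η,
      y ∈ shell D c ∧ dist (radialProj D c y) q.1 ≤ ε := by
    intro q hq y hy
    rw [Finset.mem_product, Finset.mem_range, hm] at hq
    rw [hz] at hy
    have h := dist_radialProj_le hDo hDc hc hL (hND hq.1) (hR _ (hND hq.1)) hLη
      (segment_param_mem_Icc hr hη hq.2) (Metric.mem_ball.1 hy).le
    exact ⟨h.1, h.2.trans hε⟩
  have hdisj : ((N ×ˢ Finset.range m : Finset (Euc d × ℕ)) : Set (Euc d × ℕ)).PairwiseDisjoint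
      (fun q => Metric.ball (z q) η) := by
    intro q hq q' hq' hne
    rw [Finset.mem_coe] at hq hq'
    by_cases h1 : q.1 = q'.1
    · have h2 : q.2 ≠ q'.2 := fun h => hne (Prod.ext h1 h)
      have h3 := disjoint_balls_on_ray (c := c) hr hη
        (hra _ (hND (Finset.mem_product.1 hq).1)) h2
      change Disjoint (Metric.ball (z q) η) (Metric.ball (z q') η)
      rw [hz, hz, ← h1]
      exact h3
    · refine Set.disjoint_left.2 fun y hy hy' => ?_
      have h2 := (key q hq y hy).2
      have h3 := (key q' hq' y hy').2
      have h4 := hN q.1 (Finset.mem_product.1 hq).1 q'.1 (Finset.mem_product.1 hq').1 h1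
      have h5 := dist_triangle_left q.1 q'.1 (radialProj D c y)
      linarith
  have hcard : (N.card : ℝ) * (r / (8 * η)) ≤ ((N ×ˢ Finset.range m).card : ℝ) := by
    rw [Finset.card_product, Finset.card_range, Nat.cast_mul, hm]
    push_cast
    have := (Nat.lt_floor_add_one (r / (8 * η))).le
    gcongr
  have hle : (N.card : ℝ) * (r / (8 * η)) * η ^ d ≤
      ((N ×ˢ Finset.range m).card : ℝ) * η ^ d := by gcongr
  have hsub : (⋃ q ∈ N ×ˢ Finset.range m, Metric.ball (z q) η) ⊆
      shell D c ∩ radialProj D c ⁻¹' Metric.cthickening ε A := by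
    intro y hy
    simp only [mem_iUnion] at hy
    obtain ⟨q, hq, hy⟩ := hy
    have h := key q hq y hy
    refine mem_inter h.1 (mem_preimage.2 ?_)
    exact Metric.mem_cthickening_of_dist_le (radialProj D c y) q.1 ε A
      (hNA (Finset.mem_product.1 hq).1) h.2
  have hsum := sum_volume_ball (N ×ˢ Finset.range m) z hη
  have hunion := measure_biUnion_finset (μ := (volume : Measure (Euc d))) hdisj
    fun q _ => Metric.isOpen_ball.measurableSet
  grw [hle, ← hsum, ← hunion, hsub]

/-- A compact set contains a finite `ε`-separated `ε`-net. -/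
theorem exists_finset_separated_cover {A : Set (Euc d)} (hA : IsCompact A) {ε : ℝ} (hε : 0 < ε) :
    ∃ N : Finset (Euc d), ↑N ⊆ A ∧ (∀ a ∈ N, ∀ b ∈ N, a ≠ b → ε < dist a b) ∧
      A ⊆ ⋃ a : N, Metric.closedBall (a : Euc d) ε := by
  lift ε to NNReal using hε.le
  have hε' : 0 < ε := by exact_mod_cast hε
  have hpack : Metric.packingNumber ε A ≠ ⊤ := by
    obtain ⟨C, -, hCf, hC⟩ :=
      Metric.exists_finite_isCover_of_isCompact (ε := ε / 2) (by positivity) hA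
    have h1 := Metric.packingNumber_two_mul_le_externalCoveringNumber (ε / 2) A
    rw [mul_div_cancel₀ _ two_ne_zero] at h1
    exact ne_top_of_le_ne_top hCf.encard_lt_top.ne
      (h1.trans hC.externalCoveringNumber_le_encard)
  have hfin : (Metric.maximalSeparatedSet ε A).Finite := by
    rw [← Set.encard_ne_top_iff, Metric.encard_maximalSeparatedSet hpack]
    exact hpack
  refine ⟨hfin.toFinset, ?_, ?_, ?_⟩
  · rw [hfin.coe_toFinset]
    exact Metric.maximalSeparatedSet_subset
  · intro a ha b hb hab
    have : (ε : ℝ≥0∞) < edist a b := Metric.isSeparated_maximalSeparatedSet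
      (hfin.mem_toFinset.1 ha) (hfin.mem_toFinset.1 hb) hab
    rw [edist_dist, ← ENNReal.ofReal_coe_nnreal] at this
    exact (ENNReal.ofReal_lt_ofReal_iff_of_nonneg ε.coe_nonneg).1 this
  · have := Metric.isCover_iff_subset_iUnion_closedBall.1 (Metric.isCover_maximalSeparatedSet hpack)
    intro x hx
    obtain ⟨a, ha, hxa⟩ := mem_iUnion₂.1 (this hx)
    exact mem_iUnion.2 ⟨⟨a, hfin.mem_toFinset.2 ha⟩, hxa⟩

end Gauge

section Surface

variable {d : ℕ} {D : Set (Euc d)} {c : Euc d}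

theorem isCompact_frontier_of_isBounded (hDb : Bornology.IsBounded D) : IsCompact (frontier D) :=
  Metric.isCompact_of_isClosed_isBounded isClosed_frontier
    (hDb.closure.subset frontier_subset_closure)

theorem exists_radii (hDo : IsOpen D) (hDb : Bornology.IsBounded D) (hc : c ∈ D) :
    ∃ r R : ℝ, 0 < r ∧ 0 < R ∧ (∀ a ∈ frontier D, r ≤ ‖a - c‖) ∧ ∀ a ∈ closure D, ‖a - c‖ ≤ R := by
  obtain ⟨r, hr, hball⟩ := Metric.isOpen_iff.1 hDo c hc
  obtain ⟨R, hR⟩ := hDb.closure.subset_closedBall c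
  refine ⟨r, max R 1, hr, by positivity, fun a ha => ?_, fun a ha => ?_⟩
  · by_contra h
    have h1 : a ∈ D := hball (by rw [Metric.mem_ball, dist_eq_norm]; exact not_le.1 h)
    exact (hDo.frontier_eq ▸ ha).2 h1
  · rw [← dist_eq_norm]
    exact (Metric.mem_closedBall.1 (hR ha)).trans (le_max_left _ _)

/-- The measure of a compact subset of the boundary is controlled by the volume of the part of the
shell above it. A covering of `A` by balls of radius `2ε` around a maximal separated set is compared
with the packing of the shell in `card_mul_volume_ball_le`, and `ε` tends to `0`. -/
theorem exists_hausdorffMeasure_le (hDo : IsOpen D) (hDc : Convex ℝ D)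
    (hDb : Bornology.IsBounded D) (hc : c ∈ D) (hd : d ≠ 0) :
    ∃ C : ℝ≥0∞, C ≠ ⊤ ∧ ∀ A ⊆ frontier D, IsCompact A →
      (μH[(d : ℝ) - 1] : Measure (Euc d)) A ≤
        C * Measure.map (radialProj D c) (volume.restrict (shell D c)) A := by
  obtain ⟨L, hL⟩ := exists_lipschitzWith_radialGauge hDo hDc hc
  obtain ⟨r, R, hr, hR0, hra, hR⟩ := exists_radii hDo hDb hc
  have hRf : ∀ a ∈ frontier D, ‖a - c‖ ≤ R := fun a ha => hR a (frontier_subset_closure ha)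
  obtain ⟨M, hM⟩ : ∃ M : ℝ, M = 4 * (L * R + 1) := ⟨_, rfl⟩
  have hM0 : 0 < M := by rw [hM]; positivity
  obtain ⟨b, hb⟩ : ∃ b, b = volume (Metric.ball (0 : Euc d) 1) := ⟨_, rfl⟩
  have hb0 : b ≠ 0 := hb ▸ (Metric.measure_ball_pos _ _ one_pos).ne'
  have hbt : b ≠ ⊤ := hb ▸ measure_ball_lt_top.ne
  obtain ⟨ν, hν⟩ : ∃ ν, ν = Measure.map (radialProj D c) (volume.restrict (shell D c)) := ⟨_, rfl⟩
  have hshell : volume (shell D c) ≠ ⊤ :=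
    (hDb.subset (shell_subset hDo hDc hc)).measure_lt_top.ne
  have : IsFiniteMeasure (volume.restrict (shell D c)) := isFiniteMeasure_restrict.2 hshell
  have hνfin : IsFiniteMeasure ν := hν ▸ Measure.isFiniteMeasure_map _ _
  have hνapp : ∀ F, MeasurableSet F → ν F = volume (shell D c ∩ radialProj D c ⁻¹' F) := by
    intro F hF
    rw [hν, Measure.map_apply (measurable_radialProj hDo hDc hc) hF,
      Measure.restrict_apply (measurable_radialProj hDo hDc hc hF), inter_comm]
  refine ⟨ENNReal.ofReal ((4 * M) ^ ((d : ℝ) - 1) * (8 / r)) * b⁻¹,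
    ENNReal.mul_ne_top ENNReal.ofReal_ne_top (ENNReal.inv_ne_top.2 hb0), fun A hAD hA => ?_⟩
  rw [← hν]
  -- the scales `η → 0`, small enough for `card_mul_volume_ball_le`
  obtain ⟨η, hη⟩ : ∃ η : ℕ → ℝ, ∀ n, η n = 1 / (4 * L + 1) / 4 * (1 / ((n : ℝ) + 1)) :=
    ⟨_, fun _ => rfl⟩
  have hη0 : ∀ n, 0 < η n := fun n => by rw [hη]; positivity
  have hηt : Tendsto η atTop (𝓝 0) := by
    have := tendsto_one_div_add_atTop_nhds_zero_nat.const_mul (1 / (4 * (L : ℝ) + 1) / 4)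
    rw [mul_zero] at this
    exact this.congr fun n => (hη n).symm
  have hLη : ∀ n, L * η n < 1 / 4 := by
    intro n
    have h1 : η n ≤ 1 / (4 * L + 1) / 4 := by
      rw [hη]
      refine mul_le_of_le_one_right (by positivity) ?_
      rw [div_le_one (by positivity)]
      have : (0 : ℝ) ≤ n := Nat.cast_nonneg n
      linarith
    have h2 : L * η n ≤ L * (1 / (4 * L + 1) / 4) := by gcongr
    have h3 : (L : ℝ) * (1 / (4 * L + 1) / 4) < 1 / 4 := by
      have : (0 : ℝ) ≤ L := L.coe_nonneg
      rw [div_div, mul_one_div, div_lt_div_iff₀ (by positivity) (by positivity)]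
      linarith
    exact h2.trans_lt h3
  choose N hNA hNsep hNcov using fun n =>
    exists_finset_separated_cover hA (ε := 2 * (M * η n)) (by have := hη0 n; positivity)
  have hdiam : ∀ n (i : N n), Metric.ediam (Metric.closedBall (i : Euc d) (2 * (M * η n))) ≤
      ENNReal.ofReal (4 * M * η n) := by
    intro n i
    have h0 : 0 ≤ 2 * (M * η n) := by have := hη0 n; positivity
    rw [← Metric.closedEBall_ofReal h0]
    refine Metric.ediam_closedEBall_le.trans_eq ?_
    rw [show 4 * M * η n = 2 * (2 * (M * η n)) by ring,
      ENNReal.ofReal_mul (p := 2) (q := 2 * (M * η n)) zero_le_two, ENNReal.ofReal_ofNat]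
  have hlim : Tendsto (fun n => ENNReal.ofReal (4 * M * η n)) atTop (𝓝 0) := by
    have := hηt.const_mul (4 * M)
    rw [mul_zero] at this
    simpa using ENNReal.tendsto_ofReal this
  -- the coverings bound the Hausdorff measure since their mesh tends to `0`
  have hH := Measure.hausdorffMeasure_le_liminf_sum ((d : ℝ) - 1) A
    (fun n => ENNReal.ofReal (4 * M * η n)) hlim
    (fun n (i : N n) => Metric.closedBall (i : Euc d) (2 * (M * η n)))
    (Eventually.of_forall hdiam) (Eventually.of_forall hNcov)
  -- a negative exponent, for `d = 0`, would reverse the comparison of diameters below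
  have hd1 : (0 : ℝ) ≤ (d : ℝ) - 1 := by
    have : (1 : ℝ) ≤ d := by exact_mod_cast Nat.one_le_iff_ne_zero.2 hd
    linarith
  have hterm : ∀ n, ∑ i : N n,
      Metric.ediam (Metric.closedBall (i : Euc d) (2 * (M * η n))) ^ ((d : ℝ) - 1) ≤
      ENNReal.ofReal ((4 * M) ^ ((d : ℝ) - 1) * (8 / r)) * b⁻¹ *
        ν (Metric.cthickening (M * η n) A) := by
    intro n
    have hpack := card_mul_volume_ball_le hDo hDc hc hL hr (hη0 n) (hLη n) hRf hra
      (ε := M * η n) (by rw [hM]) A (N n) (hNA n) ((hNA n).trans hAD) (hNsep n)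
    rw [← hb, ← hνapp _ Metric.isClosed_cthickening.measurableSet] at hpack
    have h1 : ENNReal.ofReal ((N n).card * (r / (8 * η n)) * η n ^ d) ≤
        b⁻¹ * ν (Metric.cthickening (M * η n) A) := by
      rw [mul_comm b⁻¹, ← div_eq_mul_inv, ENNReal.le_div_iff_mul_le (Or.inl hb0) (Or.inl hbt)]
      exact hpack
    have h2 : ((N n).card : ℝ) * (4 * M * η n) ^ ((d : ℝ) - 1) =
        (4 * M) ^ ((d : ℝ) - 1) * (8 / r) * ((N n).card * (r / (8 * η n)) * η n ^ d) := by
      have h3 := hη0 n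
      rw [Real.mul_rpow (by positivity) h3.le, Real.rpow_sub_one h3.ne' (d : ℝ), Real.rpow_natCast]
      field_simp
    calc _ ≤ ∑ i : N n, ENNReal.ofReal (4 * M * η n) ^ ((d : ℝ) - 1) :=
          Finset.sum_le_sum fun i _ => ENNReal.rpow_le_rpow (hdiam n i) hd1
      _ = ENNReal.ofReal (((N n).card : ℝ) * (4 * M * η n) ^ ((d : ℝ) - 1)) := by
          rw [Finset.sum_const, Finset.card_univ, Fintype.card_coe, nsmul_eq_mul,
            ENNReal.ofReal_mul (Nat.cast_nonneg _), ENNReal.ofReal_natCast,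
            ENNReal.ofReal_rpow_of_nonneg (by have := hη0 n; positivity) hd1]
      _ ≤ _ := by
          rw [h2, ENNReal.ofReal_mul (by positivity), mul_assoc (ENNReal.ofReal _)]
          gcongr
  have hlim2 : Tendsto (fun n => ENNReal.ofReal ((4 * M) ^ ((d : ℝ) - 1) * (8 / r)) * b⁻¹ *
      ν (Metric.cthickening (M * η n) A)) atTop
      (𝓝 (ENNReal.ofReal ((4 * M) ^ ((d : ℝ) - 1) * (8 / r)) * b⁻¹ * ν A)) := by
    refine ENNReal.Tendsto.const_mul ?_
      (Or.inr (ENNReal.mul_ne_top ENNReal.ofReal_ne_top (ENNReal.inv_ne_top.2 hb0)))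
    refine (tendsto_measure_cthickening_of_isCompact hA).comp ?_
    simpa using hηt.const_mul M
  exact hH.trans ((liminf_le_liminf (Eventually.of_forall hterm)).trans hlim2.liminf_eq.le)

/-- On the boundary of a bounded convex open set, the surface measure is at most a multiple of the
image of Lebesgue measure under the radial projection. -/
theorem exists_surfaceMeasure_le (hDo : IsOpen D) (hDc : Convex ℝ D)
    (hDb : Bornology.IsBounded D) (hc : c ∈ D) :
    ∃ C : ℝ≥0∞, C ≠ ⊤ ∧ surfaceMeasure D ≤
      C • Measure.map (radialProj D c) (volume.restrict (shell D c)) := by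
  rcases (frontier D).eq_empty_or_nonempty with hf | ⟨a, ha⟩
  · exact ⟨0, by simp, by simp [surfaceMeasure, hf]⟩
  have hd : d ≠ 0 := by
    rintro rfl
    exact (hDo.frontier_eq ▸ ha).2 (Subsingleton.elim c a ▸ hc)
  obtain ⟨C, hC, h⟩ := exists_hausdorffMeasure_le hDo hDc hDb hc hd
  have hshell : volume (shell D c) ≠ ⊤ :=
    (hDb.subset (shell_subset hDo hDc hc)).measure_lt_top.ne
  have : IsFiniteMeasure (volume.restrict (shell D c)) := isFiniteMeasure_restrict.2 hshell
  have hfr := isCompact_frontier_of_isBounded hDb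
  have hfin : IsFiniteMeasure (surfaceMeasure D) := by
    refine isFiniteMeasure_restrict.2 (ne_top_of_le_ne_top ?_ (h _ Subset.rfl hfr))
    exact ENNReal.mul_ne_top hC (measure_ne_top _ _)
  refine ⟨C, hC, Measure.le_iff.2 fun s hs => ?_⟩
  rw [hs.measure_eq_iSup_isClosed_of_ne_top (measure_ne_top _ _)]
  refine iSup₂_le fun K hK => iSup_le fun hKc => ?_
  rw [surfaceMeasure, Measure.restrict_apply hKc.measurableSet, Measure.smul_apply, smul_eq_mul]
  refine (h _ inter_subset_right (hfr.inter_left hKc)).trans ?_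
  gcongr
  exact inter_subset_left.trans hK

theorem isFiniteMeasure_surfaceMeasure (hDo : IsOpen D) (hDc : Convex ℝ D)
    (hDb : Bornology.IsBounded D) (hDn : D.Nonempty) : IsFiniteMeasure (surfaceMeasure D) := by
  obtain ⟨c, hc⟩ := hDn
  obtain ⟨C, hC, h⟩ := exists_surfaceMeasure_le hDo hDc hDb hc
  have hshell : volume (shell D c) ≠ ⊤ :=
    (hDb.subset (shell_subset hDo hDc hc)).measure_lt_top.ne
  have : IsFiniteMeasure (volume.restrict (shell D c)) := isFiniteMeasure_restrict.2 hshell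
  refine ⟨(h univ).trans_lt ?_⟩
  rw [Measure.smul_apply, smul_eq_mul]
  exact ENNReal.mul_lt_top hC.lt_top (measure_lt_top _ _)

end Surface

/-! ### Integral inequalities along segments and rays -/

theorem sq_lintegral_le {α : Type*} [MeasurableSpace α] {μ : Measure α} {f : α → ℝ≥0∞}
    (hf : AEMeasurable f μ) : (∫⁻ x, f x ∂μ) ^ 2 ≤ μ univ * ∫⁻ x, f x ^ 2 ∂μ := by
  have h := ENNReal.lintegral_mul_le_Lp_mul_Lq μ Real.HolderConjugate.two_two
    (aemeasurable_const (b := (1 : ℝ≥0∞))) hf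
  simp only [Pi.mul_apply, one_mul, ENNReal.one_rpow, lintegral_const, one_div] at h
  calc (∫⁻ x, f x ∂μ) ^ 2 ≤ _ := pow_le_pow_left' h 2
    _ = μ univ * ∫⁻ x, f x ^ 2 ∂μ := by
      rw [mul_pow, ← ENNReal.rpow_mul_natCast, ← ENNReal.rpow_mul_natCast]
      norm_num

theorem add_sq_le_four_mul (a b : ℝ≥0∞) : (a + b) ^ 2 ≤ 4 * (a ^ 2 + b ^ 2) := by
  have h : a + b ≤ 2 * max a b := by
    rw [two_mul]
    exact add_le_add (le_max_left _ _) (le_max_right _ _)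
  calc (a + b) ^ 2 ≤ (2 * max a b) ^ 2 := pow_le_pow_left' h 2
    _ = 4 * max a b ^ 2 := by rw [mul_pow]; norm_num
    _ ≤ _ := by
      gcongr
      rcases max_cases a b with h | h <;> rw [h.1]
      · exact le_self_add
      · exact le_add_self

/-- The square of an increment of `φ` along a segment is controlled by the integral of the squared
derivative. -/
theorem enorm_sub_sq_le_lintegral {E : Type*} [NormedAddCommGroup E] [NormedSpace ℝ E] {φ : E → ℝ}
    (hφ : ContDiff ℝ 1 φ) (c v : E) {a b : ℝ} (hab : a ≤ b) :
    ‖φ (c + b • v) - φ (c + a • v)‖ₑ ^ 2 ≤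
      ENNReal.ofReal (b - a) * ‖v‖ₑ ^ 2 * ∫⁻ s in Ioo a b, ‖fderiv ℝ φ (c + s • v)‖ₑ ^ 2 := by
  have hline : ∀ s : ℝ, HasDerivAt (fun s : ℝ => c + s • v) v s := fun s => by
    simpa using ((hasDerivAt_id s).smul_const v).const_add c
  have hder : ∀ s : ℝ, HasDerivAt (fun s : ℝ => φ (c + s • v)) (fderiv ℝ φ (c + s • v) v) s :=
    fun s => ((hφ.differentiable one_ne_zero _).hasFDerivAt).comp_hasDerivAt s (hline s)
  have hcont : Continuous fun s : ℝ => fderiv ℝ φ (c + s • v) :=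
    (hφ.continuous_fderiv one_ne_zero).comp (by fun_prop)
  have hftc : ∫ s in a..b, fderiv ℝ φ (c + s • v) v = φ (c + b • v) - φ (c + a • v) :=
    intervalIntegral.integral_eq_sub_of_hasDerivAt (fun s _ => hder s)
      ((hcont.clm_apply continuous_const).intervalIntegrable _ _)
  have hmeas : AEMeasurable (fun s : ℝ => ‖fderiv ℝ φ (c + s • v)‖ₑ) (volume.restrict (Ioo a b)) :=
    hcont.enorm.measurable.aemeasurable
  have h1 : ‖φ (c + b • v) - φ (c + a • v)‖ₑ ≤
      ‖v‖ₑ * ∫⁻ s in Ioo a b, ‖fderiv ℝ φ (c + s • v)‖ₑ := by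
    rw [← hftc, intervalIntegral.integral_of_le hab, integral_Ioc_eq_integral_Ioo]
    refine (enorm_integral_le_lintegral_enorm _).trans ?_
    rw [← lintegral_const_mul'' _ hmeas]
    refine lintegral_mono fun s => ?_
    rw [mul_comm]
    exact ContinuousLinearMap.le_opENorm _ _
  calc _ ≤ (‖v‖ₑ * ∫⁻ s in Ioo a b, ‖fderiv ℝ φ (c + s • v)‖ₑ) ^ 2 := pow_le_pow_left' h1 2
    _ = ‖v‖ₑ ^ 2 * (∫⁻ s in Ioo a b, ‖fderiv ℝ φ (c + s • v)‖ₑ) ^ 2 := mul_pow _ _ _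
    _ ≤ ‖v‖ₑ ^ 2 * (volume.restrict (Ioo a b) univ *
          ∫⁻ s in Ioo a b, ‖fderiv ℝ φ (c + s • v)‖ₑ ^ 2) := by
        gcongr
        exact sq_lintegral_le hmeas
    _ = _ := by
        rw [Measure.restrict_apply_univ, Real.volume_Ioo]
        ring

theorem lintegral_comp_add_smul {d : ℕ} {F : Euc d → ℝ≥0∞} (hF : Measurable F) (v : Euc d) {s : ℝ}
    (hs : s ≠ 0) :
    ∫⁻ x, F (v + s • x) = ENNReal.ofReal |(s ^ d)⁻¹| * ∫⁻ x, F x := by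
  have h1 : ∫⁻ x, F (v + s • x) = ∫⁻ y, F (v + y) ∂(Measure.map (s • ·) volume) :=
    (lintegral_map (hF.comp (measurable_const_add v)) (measurable_const_smul s)).symm
  rw [h1, Measure.map_addHaar_smul _ hs, lintegral_smul_measure, lintegral_add_left_eq_self,
    finrank_euclideanSpace_fin, smul_eq_mul]

section Domain

variable {d : ℕ} {D : Set (Euc d)} {c : Euc d}

theorem ofReal_abs_inv_pow_le_two_pow {s : ℝ} (hs : 1 / 2 ≤ s) :
    ENNReal.ofReal |(s ^ d)⁻¹| ≤ 2 ^ d := by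
  have h0 : 0 < s := by linarith
  rw [abs_of_pos (by positivity), ← inv_pow]
  have : s⁻¹ ^ d ≤ 2 ^ d := by
    gcongr
    rw [inv_le_comm₀ h0 two_pos]
    simpa using hs
  calc ENNReal.ofReal (s⁻¹ ^ d) ≤ ENNReal.ofReal (2 ^ d) := ENNReal.ofReal_le_ofReal this
    _ = 2 ^ d := by rw [ENNReal.ofReal_pow zero_le_two, ENNReal.ofReal_ofNat]

/-- For each `t`, one of the two variables carries a factor at least `1/2` in the convex
combination, so that substituting for it costs at most `2 ^ d`. -/
theorem lintegral_lintegral_convexComb_le {F : Euc d → ℝ≥0∞} (hF : Measurable F) (t : ℝ) :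
    ∫⁻ x in D, ∫⁻ z in D, F (x + t • (z - x)) ≤ 2 ^ d * volume D * ∫⁻ x, F x := by
  rcases le_total (1 / 2) t with ht | ht
  · have h : ∀ x, ∫⁻ z in D, F (x + t • (z - x)) ≤ 2 ^ d * ∫⁻ x, F x := by
      intro x
      calc _ ≤ ∫⁻ z, F (x + t • (z - x)) := setLIntegral_le_lintegral _ _
        _ = ∫⁻ z, F ((x - t • x) + t • z) := by
            congr 1; funext z; congr 1; module
        _ ≤ _ := by
            rw [lintegral_comp_add_smul hF _ (by linarith)]
            gcongr
            exact ofReal_abs_inv_pow_le_two_pow ht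
    calc _ ≤ ∫⁻ x in D, 2 ^ d * ∫⁻ x, F x := lintegral_mono h
      _ = _ := by rw [setLIntegral_const]; ring
  · have h : ∀ z, ∫⁻ x in D, F (x + t • (z - x)) ≤ 2 ^ d * ∫⁻ x, F x := by
      intro z
      calc _ ≤ ∫⁻ x, F (x + t • (z - x)) := setLIntegral_le_lintegral _ _
        _ = ∫⁻ x, F (t • z + (1 - t) • x) := by
            congr 1; funext x; congr 1; module
        _ ≤ _ := by
            rw [lintegral_comp_add_smul hF _ (by linarith)]
            gcongr
            exact ofReal_abs_inv_pow_le_two_pow (by linarith)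
    rw [lintegral_lintegral_swap (by fun_prop)]
    calc _ ≤ ∫⁻ x in D, 2 ^ d * ∫⁻ x, F x := lintegral_mono h
      _ = _ := by rw [setLIntegral_const]; ring

/-- The Poincaré inequality on a bounded convex set, in the form of a bound on the mean squared
oscillation. -/
theorem lintegral_lintegral_enorm_sub_sq_le (hDo : IsOpen D) (hDc : Convex ℝ D) {R : ℝ≥0∞}
    (hR : ∀ x ∈ D, ∀ z ∈ D, ‖z - x‖ₑ ≤ R) {φ : Euc d → ℝ} (hφ : ContDiff ℝ 1 φ) :
    ∫⁻ x in D, ∫⁻ z in D, ‖φ x - φ z‖ₑ ^ 2 ≤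
      R ^ 2 * (2 ^ d * volume D) * ∫⁻ x in D, ‖fderiv ℝ φ x‖ₑ ^ 2 := by
  set F : Euc d → ℝ≥0∞ := D.indicator fun x => ‖fderiv ℝ φ x‖ₑ ^ 2 with hFdef
  have hF : Measurable F :=
    ((hφ.continuous_fderiv one_ne_zero).enorm.measurable.pow_const 2).indicator hDo.measurableSet
  have hpt : ∀ x ∈ D, ∀ z ∈ D,
      ‖φ x - φ z‖ₑ ^ 2 ≤ R ^ 2 * ∫⁻ t in Ioo (0 : ℝ) 1, F (x + t • (z - x)) := by
    intro x hx z hz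
    have h := enorm_sub_sq_le_lintegral hφ x (z - x) zero_le_one
    rw [one_smul, zero_smul, add_zero, add_sub_cancel, sub_zero, ENNReal.ofReal_one, one_mul,
      enorm_sub_rev] at h
    refine h.trans (mul_le_mul' (pow_le_pow_left' (hR x hx z hz) 2) ?_)
    refine setLIntegral_mono' measurableSet_Ioo fun t ht => ?_
    have : x + t • (z - x) ∈ D := hDc.add_smul_sub_mem hx hz ⟨ht.1.le, ht.2.le⟩
    rw [hFdef, indicator_of_mem this]
  calc _ ≤ ∫⁻ x in D, ∫⁻ z in D, R ^ 2 * ∫⁻ t in Ioo (0 : ℝ) 1, F (x + t • (z - x)) := by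
        refine setLIntegral_mono' hDo.measurableSet fun x hx => ?_
        exact setLIntegral_mono' hDo.measurableSet fun z hz => hpt x hx z hz
    _ = R ^ 2 * ∫⁻ x in D, ∫⁻ z in D, ∫⁻ t in Ioo (0 : ℝ) 1, F (x + t • (z - x)) := by
        rw [← lintegral_const_mul _ (by fun_prop)]
        congr 1; funext x
        rw [lintegral_const_mul _ (by fun_prop)]
    _ = R ^ 2 * ∫⁻ t in Ioo (0 : ℝ) 1, ∫⁻ x in D, ∫⁻ z in D, F (x + t • (z - x)) := by
        have : ∀ x, ∫⁻ z in D, ∫⁻ t in Ioo (0 : ℝ) 1, F (x + t • (z - x)) =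
            ∫⁻ t in Ioo (0 : ℝ) 1, ∫⁻ z in D, F (x + t • (z - x)) :=
          fun x => lintegral_lintegral_swap (by fun_prop)
        simp_rw [this]
        rw [lintegral_lintegral_swap]
        exact (Measurable.lintegral_prod_right' (f := fun q : (Euc d × ℝ) × Euc d =>
          F (q.1.1 + q.1.2 • (q.2 - q.1.1))) (by fun_prop)).aemeasurable
    _ ≤ R ^ 2 * ∫⁻ t in Ioo (0 : ℝ) 1, 2 ^ d * volume D * ∫⁻ x, F x := by
        gcongr with t
        exact lintegral_lintegral_convexComb_le hF t
    _ = _ := by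
        rw [setLIntegral_const, Real.volume_Ioo, hFdef, lintegral_indicator hDo.measurableSet]
        simp
        ring

/-- Integrating along the rays from `c`, the mean squared difference between the values of `φ` in
the shell and at the projection to the boundary is controlled by the gradient. -/
theorem lintegral_shell_enorm_sub_sq_le (hDo : IsOpen D) (hDc : Convex ℝ D) (hc : c ∈ D)
    {R : ℝ≥0∞} (hR : ∀ z ∈ D, ‖z - c‖ₑ ≤ R) {φ : Euc d → ℝ} (hφ : ContDiff ℝ 1 φ) :
    ∫⁻ z in shell D c, ‖φ z - φ (radialProj D c z)‖ₑ ^ 2 ≤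
      9 * R ^ 2 * ∫⁻ x in D, ‖fderiv ℝ φ x‖ₑ ^ 2 := by
  set F : Euc d → ℝ≥0∞ := D.indicator fun x => ‖fderiv ℝ φ x‖ₑ ^ 2 with hFdef
  have hF : Measurable F :=
    ((hφ.continuous_fderiv one_ne_zero).enorm.measurable.pow_const 2).indicator hDo.measurableSet
  have hpt : ∀ z ∈ shell D c, ‖φ z - φ (radialProj D c z)‖ₑ ^ 2 ≤
      3 * R ^ 2 * ∫⁻ s in Ioo (1 : ℝ) 4, F (c + s • (z - c)) := by
    intro z hz
    have hg0 : 0 < radialGauge D c z := lt_trans (by norm_num) hz.1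
    have hg1 : 1 ≤ (radialGauge D c z)⁻¹ := (one_le_inv₀ hg0).2 hz.2.le
    have hg4 : (radialGauge D c z)⁻¹ ≤ 4 := by
      rw [inv_le_comm₀ hg0 (by norm_num)]
      simpa using hz.1.le
    have h := enorm_sub_sq_le_lintegral hφ c (z - c) hg1
    rw [one_smul, add_sub_cancel, enorm_sub_rev] at h
    refine h.trans (mul_le_mul' (mul_le_mul' ?_ (pow_le_pow_left'
      (hR z (shell_subset hDo hDc hc hz)) 2)) ?_)
    · calc _ ≤ ENNReal.ofReal 3 := ENNReal.ofReal_le_ofReal (by linarith)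
        _ = 3 := ENNReal.ofReal_ofNat 3
    · calc ∫⁻ s in Ioo 1 (radialGauge D c z)⁻¹, ‖fderiv ℝ φ (c + s • (z - c))‖ₑ ^ 2
          ≤ ∫⁻ s in Ioo 1 (radialGauge D c z)⁻¹, F (c + s • (z - c)) := by
            refine setLIntegral_mono' measurableSet_Ioo fun s hs => ?_
            have : c + s • (z - c) ∈ D := by
              rw [← radialGauge_lt_one_iff hDo hDc hc,
                radialGauge_dilate (zero_le_one.trans hs.1.le)]
              calc s * radialGauge D c z < (radialGauge D c z)⁻¹ * radialGauge D c z := by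
                    gcongr
                    exact hs.2
                _ = 1 := inv_mul_cancel₀ hg0.ne'
            rw [hFdef, indicator_of_mem this]
        _ ≤ _ := lintegral_mono_set (Ioo_subset_Ioo_right hg4)
  have hslice : ∀ s ∈ Ioo (1 : ℝ) 4, ∫⁻ z in shell D c, F (c + s • (z - c)) ≤ ∫⁻ x, F x := by
    intro s hs
    calc _ ≤ ∫⁻ z, F (c + s • (z - c)) := setLIntegral_le_lintegral _ _
      _ = ∫⁻ z, F ((c - s • c) + s • z) := by
          congr 1; funext z; congr 1; module
      _ = ENNReal.ofReal |(s ^ d)⁻¹| * ∫⁻ x, F x :=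
          lintegral_comp_add_smul hF _ (by linarith [hs.1])
      _ ≤ 1 * ∫⁻ x, F x := by
          gcongr
          have h1 : 1 ≤ s ^ d := one_le_pow₀ hs.1.le
          rw [abs_of_nonneg (by positivity), ENNReal.ofReal_le_one]
          exact inv_le_one_of_one_le₀ h1
      _ = _ := one_mul _
  calc _ ≤ ∫⁻ z in shell D c, 3 * R ^ 2 * ∫⁻ s in Ioo (1 : ℝ) 4, F (c + s • (z - c)) :=
        setLIntegral_mono' (isOpen_shell hDo hDc hc).measurableSet hpt
    _ = 3 * R ^ 2 * ∫⁻ s in Ioo (1 : ℝ) 4, ∫⁻ z in shell D c, F (c + s • (z - c)) := by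
        rw [lintegral_const_mul _ (by fun_prop), lintegral_lintegral_swap (by fun_prop)]
    _ ≤ 3 * R ^ 2 * ∫⁻ s in Ioo (1 : ℝ) 4, ∫⁻ x, F x := by
        gcongr 3 * R ^ 2 * ?_
        exact setLIntegral_mono' measurableSet_Ioo hslice
    _ = _ := by
        rw [setLIntegral_const, Real.volume_Ioo, hFdef, lintegral_indicator hDo.measurableSet]
        have : ENNReal.ofReal (4 - 1) = 3 := by norm_num
        rw [this]
        ring

/-- The mean squared difference between interior and boundary values of a smooth function is
controlled by its gradient. Both the trace inequality and the Poincaré inequality for functions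
vanishing on a part of the boundary follow from it. -/
theorem exists_lintegral_interior_boundary_le (hDo : IsOpen D) (hDc : Convex ℝ D)
    (hDb : Bornology.IsBounded D) (hDn : D.Nonempty) :
    ∃ C : ℝ≥0∞, C ≠ ⊤ ∧ ∀ φ : Euc d → ℝ, ContDiff ℝ 1 φ →
      ∫⁻ x in D, ∫⁻ y, ‖φ x - φ y‖ₑ ^ 2 ∂surfaceMeasure D ≤
        C * ∫⁻ x in D, ‖fderiv ℝ φ x‖ₑ ^ 2 := by
  obtain ⟨c, hc⟩ := hDn
  obtain ⟨K, hK, hsurf⟩ := exists_surfaceMeasure_le hDo hDc hDb hc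
  set R : ℝ≥0∞ := Metric.ediam D with hR
  have hRt : R ≠ ⊤ := hDb.ediam_ne_top
  have hRD : ∀ x ∈ D, ∀ z ∈ D, ‖z - x‖ₑ ≤ R := fun x hx z hz => by
    rw [← edist_eq_enorm_sub]
    exact Metric.edist_le_ediam_of_mem hz hx
  have hV : volume D ≠ ⊤ := hDb.measure_lt_top.ne
  have hpm := measurable_radialProj hDo hDc hc
  refine ⟨K * (4 * (R ^ 2 * (2 ^ d * volume D) + 9 * R ^ 2 * volume D)), by finiteness,
    fun φ hφ => ?_⟩
  have hφm : Measurable φ := hφ.continuous.measurable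
  set I := ∫⁻ x in D, ‖fderiv ℝ φ x‖ₑ ^ 2 with hI
  -- a boundary point `y` is replaced by the projection of `z`, and `z` is the intermediate point
  -- between `x` and `y`
  have hinner : ∀ x, ∫⁻ y, ‖φ x - φ y‖ₑ ^ 2 ∂surfaceMeasure D ≤
      K * ∫⁻ z in shell D c, 4 * (‖φ x - φ z‖ₑ ^ 2 + ‖φ z - φ (radialProj D c z)‖ₑ ^ 2) := by
    intro x
    calc _ ≤ ∫⁻ y, ‖φ x - φ y‖ₑ ^ 2
            ∂(K • Measure.map (radialProj D c) (volume.restrict (shell D c))) :=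
          lintegral_mono' hsurf le_rfl
      _ = K * ∫⁻ z in shell D c, ‖φ x - φ (radialProj D c z)‖ₑ ^ 2 := by
          rw [lintegral_smul_measure, lintegral_map (by fun_prop) hpm, smul_eq_mul]
      _ ≤ _ := by
          gcongr with z
          refine le_trans ?_ (add_sq_le_four_mul _ _)
          gcongr
          rw [← sub_add_sub_cancel (φ x) (φ z)]
          exact enorm_add_le _ _
  have hm2 : Measurable fun z => ‖φ z - φ (radialProj D c z)‖ₑ ^ 2 := by fun_prop
  calc _ ≤ ∫⁻ x in D, K * ∫⁻ z in shell D c,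
          4 * (‖φ x - φ z‖ₑ ^ 2 + ‖φ z - φ (radialProj D c z)‖ₑ ^ 2) := lintegral_mono hinner
    _ = K * (4 * (∫⁻ x in D, ∫⁻ z in shell D c, ‖φ x - φ z‖ₑ ^ 2)
          + 4 * (volume D * ∫⁻ z in shell D c, ‖φ z - φ (radialProj D c z)‖ₑ ^ 2)) := by
        rw [lintegral_const_mul _ (by fun_prop)]
        congr 1
        have : ∀ x, ∫⁻ z in shell D c,
            4 * (‖φ x - φ z‖ₑ ^ 2 + ‖φ z - φ (radialProj D c z)‖ₑ ^ 2) =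
            4 * (∫⁻ z in shell D c, ‖φ x - φ z‖ₑ ^ 2) +
            4 * ∫⁻ z in shell D c, ‖φ z - φ (radialProj D c z)‖ₑ ^ 2 := by
          intro x
          rw [lintegral_const_mul _ (by fun_prop), lintegral_add_right _ hm2, mul_add]
        simp_rw [this]
        rw [lintegral_add_right _ measurable_const, lintegral_const_mul _ (by fun_prop),
          setLIntegral_const]
        ring
    _ ≤ K * (4 * (R ^ 2 * (2 ^ d * volume D) * I) + 4 * (volume D * (9 * R ^ 2 * I))) := by
        gcongr
        · refine le_trans ?_ (lintegral_lintegral_enorm_sub_sq_le hDo hDc hRD hφ)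
          gcongr with x
          exact shell_subset hDo hDc hc
        · exact lintegral_shell_enorm_sub_sq_le hDo hDc hc (hRD c hc) hφ
    _ = _ := by ring

end Domain

/-! ### The Sobolev space and its trace -/

section Sobolev

variable {d : ℕ} {D : Set (Euc d)}

/-- The inclusion of `H¹(D)` in `L²(D)` as a continuous linear map. -/
noncomputable def H1.fnL (D : Set (Euc d)) : H1 D →L[ℝ] L2 D :=
  (WithLp.fstL 2 ℝ (L2 D) (L2Vec D)).comp (H1 D).subtypeL

/-- The weak gradient as a continuous linear map. -/
noncomputable def H1.gradL (D : Set (Euc d)) : H1 D →L[ℝ] L2Vec D :=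
  (WithLp.sndL 2 ℝ (L2 D) (L2Vec D)).comp (H1 D).subtypeL

@[simp] theorem H1.fnL_apply (w : H1 D) : H1.fnL D w = H1.fn w := rfl

@[simp] theorem H1.gradL_apply (w : H1 D) : H1.gradL D w = H1.grad w := rfl

theorem H1.norm_sq_eq (w : H1 D) : ‖w‖ ^ 2 = ‖H1.fn w‖ ^ 2 + ‖H1.grad w‖ ^ 2 :=
  WithLp.prod_norm_sq_eq_of_L2 w.1

theorem H1.norm_grad_le (w : H1 D) : ‖H1.grad w‖ ≤ ‖w‖ := by
  refine le_of_sq_le_sq ?_ (norm_nonneg _)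
  rw [H1.norm_sq_eq]
  nlinarith [sq_nonneg ‖H1.fn w‖]

theorem IsTestFunction.memLp_smul_const {φ : Euc d → ℝ} (h : IsTestFunction D φ) (e : Euc d) :
    MemLp (fun x => φ x • e) 2 (volume.restrict D) :=
  (ContinuousLinearMap.toSpanSingleton ℝ e).comp_memLp' h.memLp

theorem IsTestFunction.integral_mul_fderiv_eq {φ : Euc d → ℝ} (h : IsTestFunction D φ) (e : Euc d)
    (u : L2 D) :
    ∫ x in D, u x * fderiv ℝ φ x e = inner ℝ ((h.memLp_fderiv e).toLp _) u := by
  rw [L2.inner_def]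
  refine integral_congr_ae ?_
  filter_upwards [(h.memLp_fderiv e).coeFn_toLp] with x hx
  rw [hx]
  simp

theorem IsTestFunction.integral_inner_mul_eq {φ : Euc d → ℝ} (h : IsTestFunction D φ) (e : Euc d)
    (G : L2Vec D) :
    ∫ x in D, inner ℝ (G x) e * φ x = inner ℝ ((h.memLp_smul_const e).toLp _) G := by
  rw [L2.inner_def]
  refine integral_congr_ae ?_
  filter_upwards [(h.memLp_smul_const e).coeFn_toLp] with x hx
  rw [hx, real_inner_smul_left, real_inner_comm, mul_comm]

theorem isClosed_H1 : IsClosed (H1 D : Set (WithLp 2 (L2 D × L2Vec D))) := by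
  have hset : (H1 D : Set (WithLp 2 (L2 D × L2Vec D))) =
      ⋂ (φ : Euc d → ℝ) (hφ : IsTestFunction D φ) (e : Euc d),
        {w | inner ℝ ((hφ.memLp_fderiv e).toLp _) w.fst =
          - inner ℝ ((hφ.memLp_smul_const e).toLp _) w.snd} := by
    ext w
    simp only [mem_iInter]
    refine forall_congr' fun φ => forall_congr' fun hφ => forall_congr' fun e => ?_
    rw [hφ.integral_mul_fderiv_eq, hφ.integral_inner_mul_eq]
    rfl
  rw [hset]
  refine isClosed_iInter fun φ => isClosed_iInter fun hφ => isClosed_iInter fun e => ?_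
  have h1 : Continuous fun w : WithLp 2 (L2 D × L2Vec D) => w.fst :=
    (WithLp.fstL 2 ℝ (L2 D) (L2Vec D)).continuous
  have h2 : Continuous fun w : WithLp 2 (L2 D × L2Vec D) => w.snd :=
    (WithLp.sndL 2 ℝ (L2 D) (L2Vec D)).continuous
  exact isClosed_eq (by fun_prop) (by fun_prop)

instance : CompleteSpace (H1 D) := isClosed_H1.completeSpace_coe

theorem enorm_sq_eq_lintegral {α E : Type*} [MeasurableSpace α] {μ : Measure α}
    [NormedAddCommGroup E] (u : Lp E 2 μ) : ‖u‖ₑ ^ 2 = ∫⁻ x, ‖u x‖ₑ ^ 2 ∂μ := by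
  have h := eLpNorm_nnreal_pow_eq_lintegral (f := u) (μ := μ) (p := 2) two_ne_zero
  rw [Lp.enorm_def]
  simpa using h

theorem lintegral_enorm_sq_congr {α E : Type*} [MeasurableSpace α] {μ : Measure α}
    [NormedAddCommGroup E] {u : Lp E 2 μ} {φ : α → E} (h : u =ᵐ[μ] φ) :
    ∫⁻ x, ‖φ x‖ₑ ^ 2 ∂μ = ‖u‖ₑ ^ 2 := by
  rw [enorm_sq_eq_lintegral]
  refine lintegral_congr_ae ?_
  filter_upwards [h] with x hx
  rw [hx]

theorem measurable_enorm_sub_sq {φ : Euc d → ℝ} (hφ : Continuous φ) :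
    Measurable fun q : Euc d × Euc d => ‖φ q.1 - φ q.2‖ₑ ^ 2 := by
  have := hφ.measurable
  fun_prop

/-- The `L²(∂D)`-norm of a boundary value is controlled by the norm in `H¹(D)`. -/
theorem exists_volume_mul_enorm_trace_le (hDo : IsOpen D) (hDc : Convex ℝ D)
    (hDb : Bornology.IsBounded D) (hDn : D.Nonempty) :
    ∃ C : ℝ≥0∞, C ≠ ⊤ ∧ ∀ z ∈ traceGraph D,
      volume D * ‖z.2‖ₑ ^ 2 ≤
        4 * (C * ‖H1.grad z.1‖ₑ ^ 2 + surfaceMeasure D univ * ‖H1.fn z.1‖ₑ ^ 2) := by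
  have := isFiniteMeasure_surfaceMeasure hDo hDc hDb hDn
  obtain ⟨C, hC, h⟩ := exists_lintegral_interior_boundary_le hDo hDc hDb hDn
  refine ⟨C, hC, fun z hz => ?_⟩
  have hcl : IsClosed {z : H1 D × L2Bdry D | volume D * ‖z.2‖ₑ ^ 2 ≤
      4 * (C * ‖H1.grad z.1‖ₑ ^ 2 + surfaceMeasure D univ * ‖H1.fn z.1‖ₑ ^ 2)} := by
    have h1 : Continuous fun z : H1 D × L2Bdry D => ‖z.2‖ₑ ^ 2 := by fun_prop
    have h2 : Continuous fun z : H1 D × L2Bdry D => ‖H1.grad z.1‖ₑ ^ 2 := by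
      simp_rw [← H1.gradL_apply]; fun_prop
    have h3 : Continuous fun z : H1 D × L2Bdry D => ‖H1.fn z.1‖ₑ ^ 2 := by
      simp_rw [← H1.fnL_apply]; fun_prop
    refine isClosed_le ((ENNReal.continuous_const_mul hDb.measure_lt_top.ne).comp h1)
      ((ENNReal.continuous_const_mul (by norm_num)).comp (Continuous.add
        ((ENNReal.continuous_const_mul hC).comp h2)
        ((ENNReal.continuous_const_mul (measure_ne_top _ _)).comp h3)))
  refine closure_minimal (s := (smoothTraceGraph D : Set (H1 D × L2Bdry D))) ?_ hcl hz
  rintro ⟨w, v⟩ ⟨φ, hφ, h1, h2, h3⟩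
  have hφ1 : ContDiff ℝ 1 φ := hφ.of_le (by norm_num)
  have hφm : Measurable φ := hφ.continuous.measurable
  have hJ : Measurable fun x => ∫⁻ y, ‖φ x - φ y‖ₑ ^ 2 ∂surfaceMeasure D :=
    (measurable_enorm_sub_sq hφ.continuous).lintegral_prod_right'
  simp only [mem_ofPred_eq]
  rw [← lintegral_enorm_sq_congr h1, ← lintegral_enorm_sq_congr h2, ← lintegral_enorm_sq_congr h3]
  have hgrad : ∫⁻ x in D, ‖gradient φ x‖ₑ ^ 2 = ∫⁻ x in D, ‖fderiv ℝ φ x‖ₑ ^ 2 := by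
    simp [gradient]
  rw [hgrad]
  calc volume D * ∫⁻ y, ‖φ y‖ₑ ^ 2 ∂surfaceMeasure D
      = ∫⁻ x in D, ∫⁻ y, ‖φ y‖ₑ ^ 2 ∂surfaceMeasure D := by rw [setLIntegral_const, mul_comm]
    _ ≤ ∫⁻ x in D, ∫⁻ y, 4 * (‖φ x - φ y‖ₑ ^ 2 + ‖φ x‖ₑ ^ 2) ∂surfaceMeasure D := by
        gcongr with x y
        refine le_trans ?_ (add_sq_le_four_mul _ _)
        gcongr
        calc ‖φ y‖ₑ = ‖φ x - (φ x - φ y)‖ₑ := by rw [sub_sub_cancel]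
          _ ≤ _ := (enorm_sub_le).trans_eq (add_comm _ _)
    _ = 4 * ((∫⁻ x in D, ∫⁻ y, ‖φ x - φ y‖ₑ ^ 2 ∂surfaceMeasure D) +
          surfaceMeasure D univ * ∫⁻ x in D, ‖φ x‖ₑ ^ 2) := by
        have : ∀ x, ∫⁻ y, 4 * (‖φ x - φ y‖ₑ ^ 2 + ‖φ x‖ₑ ^ 2) ∂surfaceMeasure D =
            4 * ((∫⁻ y, ‖φ x - φ y‖ₑ ^ 2 ∂surfaceMeasure D) +
              surfaceMeasure D univ * ‖φ x‖ₑ ^ 2) := by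
          intro x
          rw [lintegral_const_mul _ (by fun_prop), lintegral_add_right _ measurable_const,
            lintegral_const, mul_comm (surfaceMeasure D univ)]
        simp_rw [this]
        rw [lintegral_const_mul _ (by fun_prop),
          lintegral_add_right _ (by fun_prop), lintegral_const_mul _ (by fun_prop)]
    _ ≤ _ := by
        gcongr
        exact h φ hφ1

/-- A Poincaré inequality with a boundary term on `Γ`. -/
theorem exists_surfaceMeasure_mul_enorm_fn_le (hDo : IsOpen D) (hDc : Convex ℝ D)
    (hDb : Bornology.IsBounded D) (hDn : D.Nonempty) (Γ : Set (Euc d)) :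
    ∃ C : ℝ≥0∞, C ≠ ⊤ ∧ ∀ z ∈ traceGraph D,
      surfaceMeasure D Γ * ‖H1.fn z.1‖ₑ ^ 2 ≤
        4 * (C * ‖H1.grad z.1‖ₑ ^ 2 + volume D * ‖restrictTo D Γ z.2‖ₑ ^ 2) := by
  have := isFiniteMeasure_surfaceMeasure hDo hDc hDb hDn
  obtain ⟨C, hC, h⟩ := exists_lintegral_interior_boundary_le hDo hDc hDb hDn
  refine ⟨C, hC, fun z hz => ?_⟩
  have hcl : IsClosed {z : H1 D × L2Bdry D | surfaceMeasure D Γ * ‖H1.fn z.1‖ₑ ^ 2 ≤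
      4 * (C * ‖H1.grad z.1‖ₑ ^ 2 + volume D * ‖restrictTo D Γ z.2‖ₑ ^ 2)} := by
    have h1 : Continuous fun z : H1 D × L2Bdry D => ‖restrictTo D Γ z.2‖ₑ ^ 2 := by
      have : Continuous (restrictTo D Γ) :=
        (LpToLpRestrictCLM (Euc d) ℝ ℝ (surfaceMeasure D) 2 Γ).continuous
      fun_prop
    have h2 : Continuous fun z : H1 D × L2Bdry D => ‖H1.grad z.1‖ₑ ^ 2 := by
      simp_rw [← H1.gradL_apply]; fun_prop
    have h3 : Continuous fun z : H1 D × L2Bdry D => ‖H1.fn z.1‖ₑ ^ 2 := by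
      simp_rw [← H1.fnL_apply]; fun_prop
    refine isClosed_le ((ENNReal.continuous_const_mul (measure_ne_top _ _)).comp h3)
      ((ENNReal.continuous_const_mul (by norm_num)).comp (Continuous.add
        ((ENNReal.continuous_const_mul hC).comp h2)
        ((ENNReal.continuous_const_mul hDb.measure_lt_top.ne).comp h1)))
  refine closure_minimal (s := (smoothTraceGraph D : Set (H1 D × L2Bdry D))) ?_ hcl hz
  rintro ⟨w, v⟩ ⟨φ, hφ, h1, h2, h3⟩
  have hφ1 : ContDiff ℝ 1 φ := hφ.of_le (by norm_num)
  have hφm : Measurable φ := hφ.continuous.measurable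
  have hJ : Measurable fun x => ∫⁻ y in Γ, ‖φ x - φ y‖ₑ ^ 2 ∂surfaceMeasure D :=
    (measurable_enorm_sub_sq hφ.continuous).lintegral_prod_right'
  have h4 : restrictTo D Γ v =ᵐ[(surfaceMeasure D).restrict Γ] φ :=
    (LpToLpRestrictCLM_coeFn (𝕜 := ℝ) Γ v).trans (ae_restrict_of_ae h3)
  simp only [mem_ofPred_eq]
  rw [← lintegral_enorm_sq_congr h1, ← lintegral_enorm_sq_congr h2, ← lintegral_enorm_sq_congr h4]
  have hgrad : ∫⁻ x in D, ‖gradient φ x‖ₑ ^ 2 = ∫⁻ x in D, ‖fderiv ℝ φ x‖ₑ ^ 2 := by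
    simp [gradient]
  rw [hgrad]
  calc surfaceMeasure D Γ * ∫⁻ x in D, ‖φ x‖ₑ ^ 2
      = ∫⁻ x in D, ∫⁻ y in Γ, ‖φ x‖ₑ ^ 2 ∂surfaceMeasure D := by
        simp_rw [setLIntegral_const]
        rw [lintegral_mul_const _ (by fun_prop), mul_comm]
    _ ≤ ∫⁻ x in D, ∫⁻ y in Γ, 4 * (‖φ x - φ y‖ₑ ^ 2 + ‖φ y‖ₑ ^ 2) ∂surfaceMeasure D := by
        gcongr with x y
        refine le_trans ?_ (add_sq_le_four_mul _ _)
        gcongr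
        calc ‖φ x‖ₑ = ‖(φ x - φ y) + φ y‖ₑ := by rw [sub_add_cancel]
          _ ≤ _ := enorm_add_le _ _
    _ = 4 * ((∫⁻ x in D, ∫⁻ y in Γ, ‖φ x - φ y‖ₑ ^ 2 ∂surfaceMeasure D) +
          volume D * ∫⁻ y in Γ, ‖φ y‖ₑ ^ 2 ∂surfaceMeasure D) := by
        have : ∀ x, ∫⁻ y in Γ, 4 * (‖φ x - φ y‖ₑ ^ 2 + ‖φ y‖ₑ ^ 2) ∂surfaceMeasure D =
            4 * ((∫⁻ y in Γ, ‖φ x - φ y‖ₑ ^ 2 ∂surfaceMeasure D) +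
              ∫⁻ y in Γ, ‖φ y‖ₑ ^ 2 ∂surfaceMeasure D) := by
          intro x
          rw [lintegral_const_mul _ (by fun_prop), lintegral_add_right _ (by fun_prop)]
        simp_rw [this]
        rw [lintegral_const_mul _ (by fun_prop),
          lintegral_add_right _ (by fun_prop), setLIntegral_const, mul_comm (volume D)]
    _ ≤ _ := by
        gcongr
        refine le_trans ?_ (h φ hφ1)
        gcongr with x
        exact Measure.restrict_le_self

end Sobolev

section TraceConsequences

variable {d : ℕ} {D Γ₀ Γ₁ : Set (Euc d)}

theorem norm_le_of_mul_enorm_sq_le {E F : Type*} [SeminormedAddCommGroup E]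
    [SeminormedAddCommGroup F] {V K : ℝ≥0∞} (hV : V ≠ 0) (hVt : V ≠ ⊤) (hK : K ≠ ⊤)
    {a : E} {b : F} (h : V * ‖a‖ₑ ^ 2 ≤ K * ‖b‖ₑ ^ 2) :
    ‖a‖ ≤ √(K / V).toReal * ‖b‖ := by
  have h1 : ‖a‖ₑ ^ 2 ≤ K / V * ‖b‖ₑ ^ 2 := by
    rw [← ENNReal.mul_div_right_comm, ENNReal.le_div_iff_mul_le (Or.inl hV) (Or.inl hVt), mul_comm]
    exact h
  have h2 := ENNReal.toReal_mono (by finiteness) h1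
  rw [ENNReal.toReal_mul, ENNReal.toReal_pow, ENNReal.toReal_pow, toReal_enorm, toReal_enorm] at h2
  refine le_of_sq_le_sq ?_ (by positivity)
  rw [mul_pow, Real.sq_sqrt ENNReal.toReal_nonneg]
  exact h2

theorem H1.enorm_fn_le (w : H1 D) : ‖H1.fn w‖ₑ ≤ ‖w‖ₑ := by
  rw [← ofReal_norm, ← ofReal_norm]
  refine ENNReal.ofReal_le_ofReal (le_of_sq_le_sq ?_ (norm_nonneg _))
  rw [H1.norm_sq_eq]
  nlinarith [sq_nonneg ‖H1.grad w‖]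

theorem H1.enorm_grad_le (w : H1 D) : ‖H1.grad w‖ₑ ≤ ‖w‖ₑ := by
  rw [← ofReal_norm, ← ofReal_norm]
  exact ENNReal.ofReal_le_ofReal (H1.norm_grad_le w)

/-- The trace inequality. -/
theorem exists_norm_le_of_mem_traceGraph (hDo : IsOpen D) (hDc : Convex ℝ D)
    (hDb : Bornology.IsBounded D) (hDn : D.Nonempty) :
    ∃ C : ℝ, 0 ≤ C ∧ ∀ z ∈ traceGraph D, ‖z.2‖ ≤ C * ‖z.1‖ := by
  have := isFiniteMeasure_surfaceMeasure hDo hDc hDb hDn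
  obtain ⟨C, hC, h⟩ := exists_volume_mul_enorm_trace_le hDo hDc hDb hDn
  refine ⟨_, Real.sqrt_nonneg _, fun z hz =>
    norm_le_of_mul_enorm_sq_le (a := z.2) (b := z.1) (hDo.measure_pos volume hDn).ne' hDb.measure_lt_top.ne
      (K := 4 * (C + surfaceMeasure D univ)) (by finiteness) ?_⟩
  calc _ ≤ _ := h z hz
    _ ≤ 4 * (C * ‖z.1‖ₑ ^ 2 + surfaceMeasure D univ * ‖z.1‖ₑ ^ 2) := by
        gcongr
        · exact H1.enorm_grad_le _
        · exact H1.enorm_fn_le _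
    _ = _ := by ring

theorem trace_eq_of_mem (hDo : IsOpen D) (hDc : Convex ℝ D)
    (hDb : Bornology.IsBounded D) (hDn : D.Nonempty) {w : H1 D} {v : L2Bdry D}
    (h : (w, v) ∈ traceGraph D) : trace w = v := by
  have hex : ∃ v : L2Bdry D, (w, v) ∈ traceGraph D := ⟨v, h⟩
  have h1 : (w, trace w) ∈ traceGraph D := by
    rw [trace, dif_pos hex]
    exact hex.choose_spec
  obtain ⟨C, -, hC⟩ := exists_norm_le_of_mem_traceGraph hDo hDc hDb hDn
  have h2 := hC _ (Submodule.sub_mem _ h1 h)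
  simp only [Prod.mk_sub_mk, sub_self, norm_zero, mul_zero] at h2
  exact sub_eq_zero.1 (norm_le_zero_iff.1 h2)

theorem mem_H1Zero_iff {w : H1 D} :
    w ∈ H1Zero D Γ₀ ↔ ∃ v, (w, v) ∈ traceGraph D ∧ restrictTo D Γ₀ v = 0 := by
  constructor
  · rintro ⟨⟨w', v⟩, ⟨h1, h2⟩, rfl⟩
    exact ⟨v, h1, h2⟩
  · rintro ⟨v, h1, h2⟩
    exact ⟨(w, v), ⟨h1, h2⟩, rfl⟩

theorem mk_trace_mem_traceGraph {w : H1 D} (hw : w ∈ H1Zero D Γ₀) :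
    (w, trace w) ∈ traceGraph D := by
  obtain ⟨v, hv, -⟩ := mem_H1Zero_iff.1 hw
  have hex : ∃ v : L2Bdry D, (w, v) ∈ traceGraph D := ⟨v, hv⟩
  rw [trace, dif_pos hex]
  exact hex.choose_spec

/-- The projection to the first factor of a closed subspace of a product is closed if on that
subspace the second entry is bounded by the first. -/
theorem isClosed_map_fst {E F : Type*} [NormedAddCommGroup E] [NormedSpace ℝ E]
    [NormedAddCommGroup F] [NormedSpace ℝ F] [CompleteSpace E] [CompleteSpace F]
    (Z : Submodule ℝ (E × F)) (hZ : IsClosed (Z : Set (E × F))) {C : ℝ} (hC0 : 0 ≤ C)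
    (hC : ∀ z ∈ Z, ‖z.2‖ ≤ C * ‖z.1‖) :
    IsClosed (Z.map (LinearMap.fst ℝ E F) : Set E) := by
  have : CompleteSpace Z := hZ.completeSpace_coe
  let P : Z →ₗ[ℝ] E := (LinearMap.fst ℝ E F).comp Z.subtype
  have hP : UniformContinuous P := uniformContinuous_fst.comp uniformContinuous_subtype_val
  have hanti : AntilipschitzWith (max 1 ⟨C, hC0⟩) P := by
    refine AddMonoidHomClass.antilipschitz_of_bound P fun z => ?_
    change ‖(z : E × F)‖ ≤ max 1 C * ‖(z : E × F).1‖
    rw [Prod.norm_def]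
    refine max_le ?_ ((hC _ z.2).trans ?_)
    · exact le_mul_of_one_le_left (norm_nonneg _) (le_max_left _ _)
    · gcongr
      exact le_max_right _ _
  have hrange : range P = (Z.map (LinearMap.fst ℝ E F) : Set E) := by
    ext w
    constructor
    · rintro ⟨z, rfl⟩
      exact ⟨z, z.2, rfl⟩
    · rintro ⟨z, hz, rfl⟩
      exact ⟨⟨z, hz⟩, rfl⟩
  rw [← hrange]
  exact hanti.isClosed_range hP

theorem isClosed_H1Zero (hDo : IsOpen D) (hDc : Convex ℝ D)
    (hDb : Bornology.IsBounded D) (hDn : D.Nonempty) (Γ₀ : Set (Euc d)) :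
    IsClosed (H1Zero D Γ₀ : Set (H1 D)) := by
  obtain ⟨C, hC0, hC⟩ := exists_norm_le_of_mem_traceGraph hDo hDc hDb hDn
  have hcont : Continuous fun z : H1 D × L2Bdry D => restrictTo D Γ₀ z.2 :=
    (LpToLpRestrictCLM (Euc d) ℝ ℝ (surfaceMeasure D) 2 Γ₀).continuous.comp continuous_snd
  have h1 : IsClosed (traceGraph D : Set (H1 D × L2Bdry D)) :=
    Submodule.isClosed_topologicalClosure _
  have h2 : IsClosed {z : H1 D × L2Bdry D | restrictTo D Γ₀ z.2 = 0} :=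
    isClosed_eq hcont continuous_const
  have hZ : ∀ z : H1 D × L2Bdry D, z ∈ traceGraph D ⊓ (LinearMap.ker (restrictTo D Γ₀)).comap
      (LinearMap.snd ℝ (H1 D) (L2Bdry D)) ↔ z ∈ traceGraph D ∧ restrictTo D Γ₀ z.2 = 0 := by
    intro z
    rw [Submodule.mem_inf, Submodule.mem_comap, LinearMap.mem_ker, LinearMap.snd_apply]
  unfold H1Zero
  refine isClosed_map_fst _ ?_ hC0 fun z hz => hC z ((hZ z).1 hz).1
  convert h1.inter h2 using 1
  ext z
  rw [SetLike.mem_coe, hZ]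
  exact Iff.rfl

/-- The Poincaré inequality on `H¹_{Γ₀}(D)`, which rests on `Γ₀` having positive surface
measure. -/
theorem exists_norm_le_norm_grad (hDo : IsOpen D) (hDc : Convex ℝ D)
    (hDb : Bornology.IsBounded D) (hDn : D.Nonempty) (hΓ₀ : 0 < surfaceMeasure D Γ₀) :
    ∃ c : ℝ, 0 < c ∧ ∀ w ∈ H1Zero D Γ₀, c * ‖w‖ ^ 2 ≤ ‖H1.grad w‖ ^ 2 := by
  have := isFiniteMeasure_surfaceMeasure hDo hDc hDb hDn
  obtain ⟨C, hC, h⟩ := exists_surfaceMeasure_mul_enorm_fn_le hDo hDc hDb hDn Γ₀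
  obtain ⟨K, hK⟩ : ∃ K : ℝ, K = √((4 * C) / surfaceMeasure D Γ₀).toReal := ⟨_, rfl⟩
  refine ⟨1 / (K ^ 2 + 1), by positivity, fun w hw => ?_⟩
  obtain ⟨v, hv, hv0⟩ := mem_H1Zero_iff.1 hw
  have h1 := h _ hv
  simp only [hv0, enorm_zero, ne_eq, OfNat.ofNat_ne_zero, not_false_eq_true, zero_pow, mul_zero,
    add_zero] at h1
  rw [← mul_assoc] at h1
  have h2 := norm_le_of_mul_enorm_sq_le hΓ₀.ne' (measure_ne_top _ _) (by finiteness) h1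
  rw [← hK] at h2
  have h3 : ‖H1.fn w‖ ^ 2 ≤ K ^ 2 * ‖H1.grad w‖ ^ 2 := by
    rw [← mul_pow]
    gcongr
  rw [one_div, inv_mul_le_iff₀ (by positivity), H1.norm_sq_eq]
  linarith

/-- The load `φ ↦ ⟨f, φ⟩ + ⟨g, (T φ)|_{Γ₁}⟩` is a continuous linear functional on `H¹_{Γ₀}(D)`. -/
theorem exists_load (hDo : IsOpen D) (hDc : Convex ℝ D)
    (hDb : Bornology.IsBounded D) (hDn : D.Nonempty) (f : H1Zero D Γ₀ →L[ℝ] ℝ)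
    (g : HHalf D Γ₁ →ₗ[ℝ] ℝ) (hg : IsHNegHalf g) :
    ∃ ℓ : H1Zero D Γ₀ →L[ℝ] ℝ, ∀ φ : H1Zero D Γ₀, ℓ φ = f φ + g (traceOn Γ₁ φ.1) := by
  obtain ⟨C, hC⟩ := hg
  have hadd : ∀ a b : H1Zero D Γ₀,
      traceOn Γ₁ (a + b).1 = traceOn Γ₁ a.1 + traceOn Γ₁ b.1 := by
    intro a b
    refine Subtype.ext ?_
    have h := trace_eq_of_mem hDo hDc hDb hDn
      (Submodule.add_mem _ (mk_trace_mem_traceGraph a.2) (mk_trace_mem_traceGraph b.2))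
    change restrictTo D Γ₁ (trace (a.1 + b.1)) = _
    rw [h, map_add]
    rfl
  have hsmul : ∀ (r : ℝ) (a : H1Zero D Γ₀), traceOn Γ₁ (r • a).1 = r • traceOn Γ₁ a.1 := by
    intro r a
    refine Subtype.ext ?_
    have h := trace_eq_of_mem hDo hDc hDb hDn
      (Submodule.smul_mem _ r (mk_trace_mem_traceGraph a.2))
    change restrictTo D Γ₁ (trace (r • a.1)) = _
    rw [h, map_smul]
    rfl
  let G : H1Zero D Γ₀ →ₗ[ℝ] ℝ :=
    { toFun := fun φ => g (traceOn Γ₁ φ.1)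
      map_add' := fun a b => by rw [hadd, map_add]
      map_smul' := fun r a => by rw [hsmul, map_smul]; rfl }
  refine ⟨f + G.mkContinuous C fun φ => ?_, fun φ => rfl⟩
  exact hC (traceOn Γ₁ φ.1) φ.1 (trace φ.1) (mk_trace_mem_traceGraph φ.2) rfl

end TraceConsequences

/-! ### The weak problem with a bounded coefficient -/

section WeakProblem

variable {d : ℕ} {D : Set (Euc d)}

/-- Multiplication by a bounded coefficient as a bounded operator on `L²(D; ℝ^d)`. -/
theorem exists_coefMul {k : Euc d → ℝ} (hk : AEMeasurable k (volume.restrict D)) {b : ℝ}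
    (hb : ∀ᵐ x ∂volume.restrict D, |k x| ≤ b) :
    ∃ M : L2Vec D →L[ℝ] L2Vec D, ∀ G, M G =ᵐ[volume.restrict D] fun x => k x • G x := by
  have hbound : ∀ G : L2Vec D, ∀ᵐ x ∂volume.restrict D, ‖k x • G x‖ ≤ b * ‖G x‖ := by
    intro G
    filter_upwards [hb] with x hx
    rw [norm_smul, Real.norm_eq_abs]
    gcongr
  have hmem : ∀ G : L2Vec D, MemLp (fun x => k x • G x) 2 (volume.restrict D) := fun G =>
    (Lp.memLp G).of_le_mul (hk.aestronglyMeasurable.smul (Lp.aestronglyMeasurable G)) (hbound G)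
  let M : L2Vec D →ₗ[ℝ] L2Vec D :=
    { toFun := fun G => (hmem G).toLp _
      map_add' := fun G H => by
        refine Lp.ext ?_
        filter_upwards [(hmem (G + H)).coeFn_toLp, (hmem G).coeFn_toLp, (hmem H).coeFn_toLp,
          Lp.coeFn_add G H, Lp.coeFn_add ((hmem G).toLp _) ((hmem H).toLp _)]
          with x h1 h2 h3 h4 h5
        rw [h1, h5, Pi.add_apply, h2, h3, h4, Pi.add_apply, smul_add]
      map_smul' := fun r G => by
        refine Lp.ext ?_
        filter_upwards [(hmem (r • G)).coeFn_toLp, (hmem G).coeFn_toLp,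
          Lp.coeFn_smul r G, Lp.coeFn_smul r ((hmem G).toLp _)] with x h1 h2 h3 h4
        rw [h1, RingHom.id_apply, h4, Pi.smul_apply, h2, h3, Pi.smul_apply, smul_comm] }
  refine ⟨M.mkContinuous b fun G => ?_, fun G => (hmem G).coeFn_toLp⟩
  refine Lp.norm_le_mul_norm_of_ae_le_mul ?_
  filter_upwards [hbound G, (hmem G).coeFn_toLp] with x h1 h2
  change ‖((hmem G).toLp _ : Euc d → Euc d) x‖ ≤ _
  rw [h2]
  exact h1

theorem integral_coef_mul_inner_eq {k : Euc d → ℝ} {M : L2Vec D →L[ℝ] L2Vec D} {G : L2Vec D}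
    (hM : M G =ᵐ[volume.restrict D] fun x => k x • G x) (H : L2Vec D) :
    ∫ x in D, k x * inner ℝ (G x) (H x) = inner ℝ (M G) H := by
  rw [L2.inner_def]
  refine integral_congr_ae ?_
  filter_upwards [hM] with x hx
  rw [hx, real_inner_smul_left]

/-- A lower bound of the energy by the norm of the gradient. -/
theorem mul_norm_sq_le_integral_coef {k : Euc d → ℝ} (hk : AEMeasurable k (volume.restrict D))
    {a b : ℝ} (ha : ∀ᵐ x ∂volume.restrict D, a ≤ k x) (hb : ∀ᵐ x ∂volume.restrict D, |k x| ≤ b)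
    (G : L2Vec D) : a * ‖G‖ ^ 2 ≤ ∫ x in D, k x * inner ℝ (G x) (G x) := by
  rw [← real_inner_self_eq_norm_sq, L2.inner_def, ← integral_const_mul]
  refine integral_mono_ae ((L2.integrable_inner G G).const_mul a)
    ((L2.integrable_inner G G).bdd_mul hk.aestronglyMeasurable (c := b) hb) ?_
  filter_upwards [ha] with x hx
  exact mul_le_mul_of_nonneg_right hx real_inner_self_nonneg

section Abstract

variable {V : Type*} [NormedAddCommGroup V] [InnerProductSpace ℝ V]

/-- Existence and uniqueness for the weak problem, by the Lax–Milgram theorem, on a Hilbert space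
`V` with a gradient `A` that is bounded from below. -/
theorem existsUnique_weak [CompleteSpace V] {A : V →L[ℝ] L2Vec D} {c : ℝ} (hc : 0 < c)
    (hA : ∀ u, c * ‖u‖ ^ 2 ≤ ‖A u‖ ^ 2)
    {k : Euc d → ℝ} (hk : AEMeasurable k (volume.restrict D))
    {a b : ℝ} (ha0 : 0 < a) (ha : ∀ᵐ x ∂volume.restrict D, a ≤ k x)
    (hb : ∀ᵐ x ∂volume.restrict D, |k x| ≤ b) (ℓ : V →L[ℝ] ℝ) :
    ∃! u : V, ∀ φ : V, ∫ x in D, k x * inner ℝ (A u x) (A φ x) = ℓ φ := by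
  obtain ⟨M, hM⟩ := exists_coefMul hk hb
  obtain ⟨B, hB⟩ : ∃ B : V →L[ℝ] V →L[ℝ] ℝ, ∀ u φ, B u φ =
      ∫ x in D, k x * inner ℝ (A u x) (A φ x) := by
    refine ⟨(innerSL ℝ).bilinearComp (M.comp A) A, fun u φ => ?_⟩
    rw [integral_coef_mul_inner_eq (hM _)]
    rfl
  have hcoer : IsCoercive B := by
    refine ⟨a * c, by positivity, fun u => ?_⟩
    rw [hB]
    have h2 := mul_norm_sq_le_integral_coef hk ha hb (A u)
    have h3 := mul_le_mul_of_nonneg_left (hA u) ha0.le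
    nlinarith
  have hiff : ∀ u : V, (∀ φ : V, ∫ x in D, k x * inner ℝ (A u x) (A φ x) = ℓ φ) ↔
      hcoer.continuousLinearEquivOfBilin u = (InnerProductSpace.toDual ℝ V).symm ℓ := by
    intro u
    simp_rw [← hB, ← hcoer.continuousLinearEquivOfBilin_apply]
    constructor
    · intro h
      refine ext_inner_right ℝ fun φ => ?_
      rw [h, InnerProductSpace.toDual_symm_apply]
    · intro h φ
      rw [h, InnerProductSpace.toDual_symm_apply]
  simp_rw [hiff]
  exact hcoer.continuousLinearEquivOfBilin.bijective.existsUnique _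

theorem tendsto_coefMul {k : ℕ → Euc d → ℝ} {k' : Euc d → ℝ} {b : ℝ}
    (hb : ∀ n, ∀ᵐ x ∂volume.restrict D, |k n x| ≤ b) (hb' : ∀ᵐ x ∂volume.restrict D, |k' x| ≤ b)
    (hlim : ∀ᵐ x ∂volume.restrict D, Tendsto (fun n => k n x) atTop (𝓝 (k' x)))
    {M : ℕ → L2Vec D →L[ℝ] L2Vec D} {M' : L2Vec D →L[ℝ] L2Vec D} {G : L2Vec D}
    (hM : ∀ n, M n G =ᵐ[volume.restrict D] fun x => k n x • G x)
    (hM' : M' G =ᵐ[volume.restrict D] fun x => k' x • G x) :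
    Tendsto (fun n => M' G - M n G) atTop (𝓝 0) := by
  have hdiff : ∀ n, (M' G - M n G : L2Vec D) =ᵐ[volume.restrict D]
      fun x => (k' x - k n x) • G x := by
    intro n
    filter_upwards [Lp.coeFn_sub (M' G) (M n G), hM n, hM'] with x h1 h2 h3
    rw [h1, Pi.sub_apply, h2, h3, sub_smul]
  have hsq : Tendsto (fun n => ‖M' G - M n G‖ₑ ^ 2) atTop (𝓝 0) := by
    simp_rw [enorm_sq_eq_lintegral]
    have hzero : ∫⁻ x in D, (0 : ℝ≥0∞) = 0 := by simp
    rw [← hzero]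
    refine tendsto_lintegral_of_dominated_convergence' (fun x => (ENNReal.ofReal (b + b)) ^ 2 *
      ‖G x‖ₑ ^ 2) (fun n => ?_) (fun n => ?_) ?_ ?_
    · exact (Lp.aestronglyMeasurable _).enorm.pow_const 2
    · filter_upwards [hdiff n, hb n, hb'] with x h1 h2 h3
      rw [h1, enorm_smul, mul_pow]
      gcongr
      rw [← ofReal_norm, Real.norm_eq_abs]
      exact ENNReal.ofReal_le_ofReal ((abs_sub _ _).trans (add_le_add h3 h2))
    · rw [lintegral_const_mul'' _ ((Lp.aestronglyMeasurable _).enorm.pow_const 2),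
        ← enorm_sq_eq_lintegral]
      finiteness
    · filter_upwards [ae_all_iff.2 hdiff, hlim] with x h1 h2
      simp_rw [h1]
      have h3 : Tendsto (fun n => (k' x - k n x) • G x) atTop (𝓝 0) := by
        have := (tendsto_const_nhds (x := k' x)).sub h2
        rw [sub_self] at this
        simpa using this.smul_const (G x)
      have h4 := (ENNReal.continuous_pow 2).tendsto _ |>.comp h3.enorm
      simpa [Function.comp_def] using h4
  have h1 : Tendsto (fun n => ‖M' G - M n G‖ ^ 2) atTop (𝓝 0) := by
    have := (ENNReal.tendsto_toReal ENNReal.zero_ne_top).comp hsq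
    refine (this.congr fun n => ?_)
    simp
  rw [tendsto_zero_iff_norm_tendsto_zero]
  have h2 := (Real.continuous_sqrt.tendsto 0).comp h1
  rw [Real.sqrt_zero] at h2
  exact h2.congr fun n => Real.sqrt_sq (norm_nonneg _)

/-- The load of the solution depends continuously on the coefficient under bounded almost
everywhere convergence. By symmetry of the form, the difference of two loads is
`∫ (k' - k n) ∇u' · ∇(u n)`, and the solutions stay bounded. -/
theorem tendsto_load_of_tendsto_coef {A : V →L[ℝ] L2Vec D} {c : ℝ} (hc : 0 < c)
    (hA : ∀ u, c * ‖u‖ ^ 2 ≤ ‖A u‖ ^ 2)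
    {k : ℕ → Euc d → ℝ} {k' : Euc d → ℝ} (hk : ∀ n, AEMeasurable (k n) (volume.restrict D))
    (hk' : AEMeasurable k' (volume.restrict D)) {a b : ℝ} (ha0 : 0 < a)
    (ha : ∀ n, ∀ᵐ x ∂volume.restrict D, a ≤ k n x)
    (hb : ∀ n, ∀ᵐ x ∂volume.restrict D, |k n x| ≤ b) (hb' : ∀ᵐ x ∂volume.restrict D, |k' x| ≤ b)
    (hlim : ∀ᵐ x ∂volume.restrict D, Tendsto (fun n => k n x) atTop (𝓝 (k' x)))
    (ℓ : V →L[ℝ] ℝ) {u : ℕ → V} {u' : V}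
    (hu : ∀ n, ∀ φ : V, ∫ x in D, k n x * inner ℝ (A (u n) x) (A φ x) = ℓ φ)
    (hu' : ∀ φ : V, ∫ x in D, k' x * inner ℝ (A u' x) (A φ x) = ℓ φ) :
    Tendsto (fun n => ℓ (u n)) atTop (𝓝 (ℓ u')) := by
  choose M hM using fun n => exists_coefMul (hk n) (hb n)
  obtain ⟨M', hM'⟩ := exists_coefMul hk' hb'
  have hbdd : ∀ n, ‖A (u n)‖ ≤ ‖A‖ * (‖ℓ‖ / (a * c)) := by
    intro n
    refine (A.le_opNorm _).trans ?_
    gcongr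
    have h1 := mul_le_mul_of_nonneg_left (hA (u n)) ha0.le
    have h2 := mul_norm_sq_le_integral_coef (hk n) (ha n) (hb n) (A (u n))
    rw [hu n (u n)] at h2
    have h3 : ℓ (u n) ≤ ‖ℓ‖ * ‖u n‖ := (le_abs_self _).trans (ℓ.le_opNorm (u n))
    rw [le_div_iff₀ (by positivity)]
    rcases (norm_nonneg (u n)).eq_or_lt with h0 | h0
    · rw [← h0, zero_mul]
      exact norm_nonneg _
    · refine le_of_mul_le_mul_right ?_ h0
      nlinarith
  have hsub : ∀ n, ℓ (u n) - ℓ u' = inner ℝ (M' (A u') - M n (A u')) (A (u n)) := by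
    intro n
    rw [inner_sub_left, ← integral_coef_mul_inner_eq (hM' _), ← integral_coef_mul_inner_eq (hM n _),
      hu', ← hu n u']
    simp_rw [real_inner_comm]
  have h0 := tendsto_coefMul hb hb' hlim (G := A u') (fun n => hM n _) (hM' _)
  rw [tendsto_iff_norm_sub_tendsto_zero]
  have h1 := (tendsto_zero_iff_norm_tendsto_zero.1 h0).mul_const (‖A‖ * (‖ℓ‖ / (a * c)))
  rw [zero_mul] at h1
  refine squeeze_zero (fun _ => norm_nonneg _) (fun n => ?_) h1
  rw [hsub]
  refine (norm_inner_le_norm _ _).trans ?_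
  gcongr
  exact hbdd n

variable {E : Type*} [NormedAddCommGroup E] [InnerProductSpace ℝ E]

/-- The form of `existsUnique_weak` for a closed subspace, on which alone the operator `A` has to be
bounded below. -/
theorem existsUnique_weak_subspace [CompleteSpace E] {W : Submodule ℝ E}
    (hW : IsClosed (W : Set E)) {A : E →L[ℝ] L2Vec D} {c : ℝ} (hc : 0 < c)
    (hA : ∀ u ∈ W, c * ‖u‖ ^ 2 ≤ ‖A u‖ ^ 2)
    {k : Euc d → ℝ} (hk : AEMeasurable k (volume.restrict D))
    {a b : ℝ} (ha0 : 0 < a) (ha : ∀ᵐ x ∂volume.restrict D, a ≤ k x)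
    (hb : ∀ᵐ x ∂volume.restrict D, |k x| ≤ b) (ℓ : W →L[ℝ] ℝ) :
    ∃! u : W, ∀ φ : W, ∫ x in D, k x * inner ℝ (A u.1 x) (A φ.1 x) = ℓ φ := by
  have : CompleteSpace W := hW.completeSpace_coe
  exact existsUnique_weak (A := A.comp W.subtypeL) hc (fun u => hA u.1 u.2) hk ha0 ha hb ℓ

/-- The form of `tendsto_load_of_tendsto_coef` for a subspace, on which alone the operator `A` has to
be bounded below. -/
theorem tendsto_load_of_tendsto_coef_subspace {W : Submodule ℝ E} {A : E →L[ℝ] L2Vec D} {c : ℝ}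
    (hc : 0 < c) (hA : ∀ u ∈ W, c * ‖u‖ ^ 2 ≤ ‖A u‖ ^ 2)
    {k : ℕ → Euc d → ℝ} {k' : Euc d → ℝ} (hk : ∀ n, AEMeasurable (k n) (volume.restrict D))
    (hk' : AEMeasurable k' (volume.restrict D)) {a b : ℝ} (ha0 : 0 < a)
    (ha : ∀ n, ∀ᵐ x ∂volume.restrict D, a ≤ k n x)
    (hb : ∀ n, ∀ᵐ x ∂volume.restrict D, |k n x| ≤ b) (hb' : ∀ᵐ x ∂volume.restrict D, |k' x| ≤ b)
    (hlim : ∀ᵐ x ∂volume.restrict D, Tendsto (fun n => k n x) atTop (𝓝 (k' x)))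
    (ℓ : W →L[ℝ] ℝ) {u : ℕ → W} {u' : W}
    (hu : ∀ n, ∀ φ : W, ∫ x in D, k n x * inner ℝ (A (u n).1 x) (A φ.1 x) = ℓ φ)
    (hu' : ∀ φ : W, ∫ x in D, k' x * inner ℝ (A u'.1 x) (A φ.1 x) = ℓ φ) :
    Tendsto (fun n => ℓ (u n)) atTop (𝓝 (ℓ u')) :=
  tendsto_load_of_tendsto_coef (A := A.comp W.subtypeL) hc (fun u => hA u.1 u.2) hk hk' ha0 ha hb
    hb' hlim ℓ hu hu'

end Abstract

end WeakProblem

/-! ### The conductivity law and the functional `J` -/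

namespace IsConductivity

variable {κ : ℝ → ℝ}

theorem zero_le_apply (hκ : IsConductivity κ) {s : ℝ} (hs : 0 ≤ s) : κ 0 ≤ κ s := by
  rcases hs.eq_or_lt with rfl | hs
  · exact le_rfl
  refine le_of_tendsto hκ.tendsto_zero ?_
  filter_upwards [Ioo_mem_nhdsGT hs] with t ht
  exact hκ.monotoneOn ht.1 hs ht.2.le

theorem exists_abs_le (hκ : IsConductivity κ) : ∃ b, ∀ s, 0 ≤ s → |κ s| ≤ b := by
  obtain ⟨b, hb⟩ := hκ.bounded
  refine ⟨max b |κ 0|, fun s hs => ?_⟩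
  rcases hs.eq_or_lt with rfl | hs
  · exact le_max_right _ _
  · exact (hb s hs).trans (le_max_left _ _)

theorem continuousOn (hκ : IsConductivity κ) : ContinuousOn κ (Ici 0) := by
  intro s hs
  rcases (mem_Ici.1 hs).eq_or_lt with rfl | hs
  · exact continuousWithinAt_Ioi_iff_Ici.1 hκ.tendsto_zero
  · exact ((hκ.contDiffOn.continuousOn).continuousAt (Ioi_mem_nhds hs)).continuousWithinAt

theorem aemeasurable_comp {α : Type*} [MeasurableSpace α] {μ : Measure α} (hκ : IsConductivity κ)
    {ρ : α → ℝ} (hρ : AEMeasurable ρ μ) (hρ0 : ∀ᵐ x ∂μ, 0 ≤ ρ x) :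
    AEMeasurable (fun x => κ (ρ x)) μ := by
  have hc : Continuous fun s => κ (max s 0) :=
    hκ.continuousOn.comp_continuous (by fun_prop) fun s => mem_Ici.2 (le_max_right _ _)
  refine (hc.measurable.comp_aemeasurable hρ).congr ?_
  filter_upwards [hρ0] with x hx
  simp [hx]

end IsConductivity

section Compliance

variable {d : ℕ} {D Γ₀ Γ₁ : Set (Euc d)} {κ : ℝ → ℝ}

theorem existsUnique_isWeakSolution (hDo : IsOpen D) (hDc : Convex ℝ D)
    (hDb : Bornology.IsBounded D) (hDn : D.Nonempty) (hΓ₀ : 0 < surfaceMeasure D Γ₀)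
    (hκ : IsConductivity κ) (f : H1Zero D Γ₀ →L[ℝ] ℝ) (g : HHalf D Γ₁ →ₗ[ℝ] ℝ) (hg : IsHNegHalf g)
    {ρ : Euc d → ℝ} (hρ : AEMeasurable ρ (volume.restrict D))
    (hρ0 : ∀ᵐ x ∂volume.restrict D, 0 ≤ ρ x) :
    ∃! u : H1Zero D Γ₀, IsWeakSolution κ f g ρ u := by
  obtain ⟨ℓ, hℓ⟩ := exists_load hDo hDc hDb hDn f g hg
  obtain ⟨b, hb⟩ := hκ.exists_abs_le
  obtain ⟨c, hc, hpoinc⟩ := exists_norm_le_norm_grad hDo hDc hDb hDn hΓ₀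
  unfold IsWeakSolution
  simp_rw [← hℓ]
  exact existsUnique_weak_subspace (E := H1 D) (A := H1.gradL D)
    (isClosed_H1Zero hDo hDc hDb hDn Γ₀) hc hpoinc (hκ.aemeasurable_comp hρ hρ0) hκ.pos_zero
    (hρ0.mono fun x hx => hκ.zero_le_apply hx) (hρ0.mono fun x hx => hb _ hx) ℓ

theorem isWeakSolution_solution (hDo : IsOpen D) (hDc : Convex ℝ D)
    (hDb : Bornology.IsBounded D) (hDn : D.Nonempty) (hΓ₀ : 0 < surfaceMeasure D Γ₀)
    (hκ : IsConductivity κ) (f : H1Zero D Γ₀ →L[ℝ] ℝ) (g : HHalf D Γ₁ →ₗ[ℝ] ℝ) (hg : IsHNegHalf g)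
    {ρ : Euc d → ℝ} (hρ : AEMeasurable ρ (volume.restrict D))
    (hρ0 : ∀ᵐ x ∂volume.restrict D, 0 ≤ ρ x) : IsWeakSolution κ f g ρ (solution κ f g ρ) := by
  have h := (existsUnique_isWeakSolution hDo hDc hDb hDn hΓ₀ hκ f g hg hρ hρ0).exists
  rw [solution, dif_pos h]
  exact h.choose_spec

/-- Testing the weak problem with its solution shows that `J(ρ)` is half the work of the load. -/
theorem compliance_eq_half_load (hDo : IsOpen D) (hDc : Convex ℝ D)
    (hDb : Bornology.IsBounded D) (hDn : D.Nonempty) (hΓ₀ : 0 < surfaceMeasure D Γ₀)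
    (hκ : IsConductivity κ) (f : H1Zero D Γ₀ →L[ℝ] ℝ) (g : HHalf D Γ₁ →ₗ[ℝ] ℝ) (hg : IsHNegHalf g)
    {ρ : Euc d → ℝ} (hρ : AEMeasurable ρ (volume.restrict D))
    (hρ0 : ∀ᵐ x ∂volume.restrict D, 0 ≤ ρ x) :
    compliance κ f g ρ =
      1 / 2 * (f (solution κ f g ρ) + g (traceOn Γ₁ (solution κ f g ρ).1)) := by
  have h := isWeakSolution_solution hDo hDc hDb hDn hΓ₀ hκ f g hg hρ hρ0 (solution κ f g ρ)
  simp_rw [real_inner_self_eq_norm_sq] at h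
  rw [compliance, h]
  ring

theorem compliance_nonneg (hDo : IsOpen D) (hDc : Convex ℝ D)
    (hDb : Bornology.IsBounded D) (hDn : D.Nonempty) (hΓ₀ : 0 < surfaceMeasure D Γ₀)
    (hκ : IsConductivity κ) (f : H1Zero D Γ₀ →L[ℝ] ℝ) (g : HHalf D Γ₁ →ₗ[ℝ] ℝ) (hg : IsHNegHalf g)
    {ρ : Euc d → ℝ} (hρ : AEMeasurable ρ (volume.restrict D))
    (hρ0 : ∀ᵐ x ∂volume.restrict D, 0 ≤ ρ x) : 0 ≤ compliance κ f g ρ := by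
  rw [compliance_eq_half_load hDo hDc hDb hDn hΓ₀ hκ f g hg hρ hρ0,
    ← isWeakSolution_solution hDo hDc hDb hDn hΓ₀ hκ f g hg hρ hρ0 (solution κ f g ρ)]
  refine mul_nonneg (by norm_num) (integral_nonneg_of_ae ?_)
  filter_upwards [hρ0] with x hx
  exact mul_nonneg (hκ.pos_zero.le.trans (hκ.zero_le_apply hx)) real_inner_self_nonneg

/-- `J` is continuous under almost everywhere convergence; the densities need no common bound
because `κ` is bounded and bounded away from zero. -/
theorem tendsto_compliance (hDo : IsOpen D) (hDc : Convex ℝ D)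
    (hDb : Bornology.IsBounded D) (hDn : D.Nonempty) (hΓ₀ : 0 < surfaceMeasure D Γ₀)
    (hκ : IsConductivity κ) (f : H1Zero D Γ₀ →L[ℝ] ℝ) (g : HHalf D Γ₁ →ₗ[ℝ] ℝ) (hg : IsHNegHalf g)
    {ρ : ℕ → Euc d → ℝ} {ρ' : Euc d → ℝ} (hρ : ∀ n, AEMeasurable (ρ n) (volume.restrict D))
    (hρ0 : ∀ n, ∀ᵐ x ∂volume.restrict D, 0 ≤ ρ n x) (hρ' : AEMeasurable ρ' (volume.restrict D))
    (hρ0' : ∀ᵐ x ∂volume.restrict D, 0 ≤ ρ' x)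
    (hlim : ∀ᵐ x ∂volume.restrict D, Tendsto (fun n => ρ n x) atTop (𝓝 (ρ' x))) :
    Tendsto (fun n => compliance κ f g (ρ n)) atTop (𝓝 (compliance κ f g ρ')) := by
  obtain ⟨ℓ, hℓ⟩ := exists_load hDo hDc hDb hDn f g hg
  obtain ⟨b, hb⟩ := hκ.exists_abs_le
  have hu := fun n => isWeakSolution_solution hDo hDc hDb hDn hΓ₀ hκ f g hg (hρ n) (hρ0 n)
  have hu' := isWeakSolution_solution hDo hDc hDb hDn hΓ₀ hκ f g hg hρ' hρ0'
  simp_rw [fun n => compliance_eq_half_load hDo hDc hDb hDn hΓ₀ hκ f g hg (hρ n) (hρ0 n),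
    compliance_eq_half_load hDo hDc hDb hDn hΓ₀ hκ f g hg hρ' hρ0']
  unfold IsWeakSolution at hu hu'
  simp_rw [← hℓ] at hu hu' ⊢
  obtain ⟨c, hc, hpoinc⟩ := exists_norm_le_norm_grad hDo hDc hDb hDn hΓ₀
  refine Tendsto.const_mul _ ?_
  refine tendsto_load_of_tendsto_coef_subspace (E := H1 D) (A := H1.gradL D) hc hpoinc
    (fun n => hκ.aemeasurable_comp (hρ n) (hρ0 n)) (hκ.aemeasurable_comp hρ' hρ0') hκ.pos_zero
    (fun n => (hρ0 n).mono fun x hx => hκ.zero_le_apply hx)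
    (fun n => (hρ0 n).mono fun x hx => hb _ hx) (hρ0'.mono fun x hx => hb _ hx) ?_ ℓ hu hu'
  filter_upwards [ae_all_iff.2 hρ0, hρ0', hlim] with x h1 h2 h3
  exact (hκ.continuousOn _ h2).tendsto.comp
    (tendsto_nhdsWithin_iff.2 ⟨h3, Eventually.of_forall h1⟩)

end Compliance

/-! ### Densities produced by the heat kernel -/

section HeatKernel

variable {d : ℕ} {D : Set (Euc d)} {p : ℝ → Euc d → Euc d → ℝ} {δ : ℝ}

theorem IsNeumannHeatKernel.continuousOn_slice (hp : IsNeumannHeatKernel D p) (hδ : 0 < δ) :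
    ContinuousOn (fun q : Euc d × Euc d => p δ q.1 q.2) (closure D ×ˢ closure D) :=
  hp.continuousOn.comp (f := fun q : Euc d × Euc d => (δ, q)) (by fun_prop)
    fun q hq => ⟨hδ, hq⟩

theorem IsNeumannHeatKernel.mem_Icc (hp : IsNeumannHeatKernel D p) (hDb : Bornology.IsBounded D)
    (hδ : 0 < δ) {x y : Euc d} (hx : x ∈ closure D) (hy : y ∈ closure D) :
    p δ x y ∈ Icc (kernelInf D p δ) (kernelSup D p δ) := by
  have hc := hp.continuousOn_slice hδ
  have hK : IsCompact (closure D ×ˢ closure D) :=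
    hDb.isCompact_closure.prod hDb.isCompact_closure
  have hsub : D ×ˢ D ⊆ closure D ×ˢ closure D := prod_mono subset_closure subset_closure
  have habove := (hK.bddAbove_image hc).mono (image_mono hsub)
  have hbelow := (hK.bddBelow_image hc).mono (image_mono hsub)
  have hxy : (x, y) ∈ closure (D ×ˢ D) := by
    rw [closure_prod_eq]
    exact ⟨hx, hy⟩
  rw [← closure_prod_eq] at hc
  constructor
  · exact le_on_closure (s := D ×ˢ D) (f := fun _ => kernelInf D p δ)
      (fun q hq => csInf_le hbelow (mem_image_of_mem _ hq)) continuousOn_const hc hxy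
  · exact le_on_closure (s := D ×ˢ D) (g := fun _ => kernelSup D p δ)
      (fun q hq => le_csSup habove (mem_image_of_mem _ hq)) hc continuousOn_const hxy

theorem IsNeumannHeatKernel.integrable_right (hp : IsNeumannHeatKernel D p)
    (hDb : Bornology.IsBounded D) (hδ : 0 < δ) {μ : Measure (Euc d)} [IsFiniteMeasure μ]
    (hμ : ∀ᵐ y ∂μ, y ∈ closure D) {x : Euc d} (hx : x ∈ closure D) :
    Integrable (fun y => p δ x y) μ := by
  have hc : ContinuousOn (fun y => p δ x y) (closure D) :=
    (hp.continuousOn_slice hδ).comp (f := fun y => (x, y)) (by fun_prop) fun y hy => ⟨hx, hy⟩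
  have hm : AEStronglyMeasurable (fun y => p δ x y) μ := by
    have := hc.aestronglyMeasurable (μ := μ) isClosed_closure.measurableSet
    rwa [Measure.restrict_eq_self_of_ae_mem hμ] at this
  refine Integrable.of_mem_Icc (kernelInf D p δ) (kernelSup D p δ) hm.aemeasurable ?_
  filter_upwards [hμ] with y hy
  exact hp.mem_Icc hDb hδ hx hy

theorem ae_mem_closure {μ : Measure (Euc d)} (hμ : μ ∈ probMeasures D) :
    ∀ᵐ y ∂μ, y ∈ closure D := hμ.2

theorem IsNeumannHeatKernel.aestronglyMeasurable_uncurry (hp : IsNeumannHeatKernel D p)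
    (hDo : IsOpen D) (hδ : 0 < δ) {μ : Measure (Euc d)} [SFinite μ]
    (hμ : ∀ᵐ y ∂μ, y ∈ closure D) :
    AEStronglyMeasurable (fun q : Euc d × Euc d => p δ q.1 q.2)
      ((volume.restrict D).prod μ) := by
  have hsub : D ×ˢ closure D ⊆ closure D ×ˢ closure D := prod_mono subset_closure Subset.rfl
  have h := ((hp.continuousOn_slice hδ).mono hsub).aestronglyMeasurable (μ := volume.prod μ)
    (hDo.measurableSet.prod isClosed_closure.measurableSet)
  rwa [← Measure.prod_restrict, Measure.restrict_eq_self_of_ae_mem hμ] at h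

/-- The heat kernel turns every probability measure on `closure D` into a density of the class
`𝒟_δ`. -/
theorem heatDensity_mem_densityClass (hp : IsNeumannHeatKernel D p) (hDo : IsOpen D)
    (hDb : Bornology.IsBounded D) (hδ : 0 < δ) {μ : Measure (Euc d)} (hμ : μ ∈ probMeasures D) :
    heatDensity p δ μ ∈ densityClass D p δ := by
  have hprob : IsProbabilityMeasure μ := hμ.1
  have hsupp := ae_mem_closure hμ
  have hD : ∀ᵐ x ∂volume.restrict D, x ∈ D := ae_restrict_mem hDo.measurableSet
  have hjoint := hp.aestronglyMeasurable_uncurry hDo hδ hsupp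
  have hmass : ∀ y ∈ closure D, ∫⁻ x in D, ENNReal.ofReal (p δ x y) = 1 := by
    intro y hy
    have h1 : ∫ x in D, p δ x y = 1 := by
      rw [← hp.mass_one δ hδ y hy]
      exact setIntegral_congr_fun hDo.measurableSet
        fun x hx => hp.symm δ hδ x (subset_closure hx) y hy
    -- the Bochner integral of a function that is not integrable is `0`, not `1`
    have hint : Integrable (fun x => p δ x y) (volume.restrict D) := by
      by_contra h
      rw [integral_undef h] at h1
      exact zero_ne_one h1
    rw [← ofReal_integral_eq_lintegral_ofReal hint, h1, ENNReal.ofReal_one]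
    filter_upwards [hD] with x hx
    exact hp.nonneg δ hδ x (subset_closure hx) y hy
  refine ⟨hjoint.integral_prod_right'.aemeasurable, ?_, ?_, ?_⟩
  · filter_upwards [hD] with x hx
    refine integral_nonneg_of_ae ?_
    filter_upwards [hsupp] with y hy
    exact hp.nonneg δ hδ x (subset_closure hx) y hy
  · calc ∫⁻ x in D, ENNReal.ofReal (heatDensity p δ μ x)
        = ∫⁻ x in D, ∫⁻ y, ENNReal.ofReal (p δ x y) ∂μ := by
          refine setLIntegral_congr_fun hDo.measurableSet fun x hx => ?_
          refine ofReal_integral_eq_lintegral_ofReal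
            (hp.integrable_right hDb hδ hsupp (subset_closure hx)) ?_
          filter_upwards [hsupp] with y hy
          exact hp.nonneg δ hδ x (subset_closure hx) y hy
      _ = ∫⁻ y, (∫⁻ x in D, ENNReal.ofReal (p δ x y)) ∂μ :=
          lintegral_lintegral_swap hjoint.aemeasurable.ennreal_ofReal
      _ = ∫⁻ y, 1 ∂μ := lintegral_congr_ae (hsupp.mono fun y hy => hmass y hy)
      _ = 1 := by simp
  · filter_upwards [hD] with x hx
    have hint := hp.integrable_right hDb hδ hsupp (subset_closure hx)
    have hI : ∀ᵐ y ∂μ, p δ x y ∈ Icc (kernelInf D p δ) (kernelSup D p δ) :=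
      hsupp.mono fun y hy => hp.mem_Icc hDb hδ (subset_closure hx) hy
    constructor
    · calc kernelInf D p δ = ∫ _, kernelInf D p δ ∂μ := by simp
        _ ≤ _ := integral_mono_ae (integrable_const _) hint (hI.mono fun y hy => hy.1)
    · calc heatDensity p δ μ x ≤ ∫ _, kernelSup D p δ ∂μ :=
          integral_mono_ae hint (integrable_const _) (hI.mono fun y hy => hy.2)
        _ = _ := by simp

/-- The measure with density `ρ` on `D`. -/
noncomputable def densityMeasure (D : Set (Euc d)) (ρ : Euc d → ℝ) : Measure (Euc d) :=
  (volume.restrict D).withDensity fun x => ENNReal.ofReal (ρ x)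

theorem densityMeasure_mem_probMeasures {ρ : Euc d → ℝ}
    (hρ : ρ ∈ densityClass D p δ) : densityMeasure D ρ ∈ probMeasures D := by
  refine ⟨⟨?_⟩, ?_⟩
  · rw [densityMeasure, withDensity_apply _ MeasurableSet.univ, Measure.restrict_univ]
    exact hρ.2.2.1
  · refine withDensity_absolutelyContinuous _ _ ?_
    rw [Measure.restrict_apply isClosed_closure.measurableSet.compl]
    have : (closure D)ᶜ ∩ D = ∅ :=
      (disjoint_compl_left.mono_right subset_closure).inter_eq
    rw [this, measure_empty]

theorem heatDensity_densityMeasure {ρ : Euc d → ℝ} (hρ : AEMeasurable ρ (volume.restrict D))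
    (hρ0 : ∀ᵐ x ∂volume.restrict D, 0 ≤ ρ x) (t : ℝ) (x : Euc d) :
    heatDensity p t (densityMeasure D ρ) x = ∫ y in D, p t x y * ρ y := by
  have h := integral_withDensity_eq_integral_smul₀ (μ := volume.restrict D)
    (f := fun x => (ρ x).toNNReal) hρ.real_toNNReal (fun y => p t x y)
  refine h.trans (integral_congr_ae ?_)
  filter_upwards [hρ0] with y hy
  rw [NNReal.smul_def, Real.coe_toNNReal _ hy, smul_eq_mul, mul_comm]

/-- The heat semigroup is continuous at time `0` in `L²(D)`; along a sequence of times this becomes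
almost everywhere convergence. -/
theorem exists_seq_heatDensity_tendsto (hp : IsNeumannHeatKernel D p)
    (hDb : Bornology.IsBounded D) {ρ : Euc d → ℝ} (hρ : ρ ∈ densityClass D p δ) :
    ∃ t : ℕ → ℝ, (∀ n, 0 < t n) ∧ Tendsto t atTop (𝓝 0) ∧
      ∀ᵐ x ∂volume.restrict D,
        Tendsto (fun n => heatDensity p (t n) (densityMeasure D ρ) x) atTop (𝓝 (ρ x)) := by
  have : IsFiniteMeasure (volume.restrict D) := isFiniteMeasure_restrict.2 hDb.measure_lt_top.ne
  have hmem : MemLp ρ 2 (volume.restrict D) := by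
    refine MemLp.of_bound hρ.1.aestronglyMeasurable (kernelSup D p δ) ?_
    filter_upwards [hρ.2.1, hρ.2.2.2] with x h1 h2
    rw [Real.norm_of_nonneg h1]
    exact h2.2
  obtain ⟨U, hU, hU0, -⟩ := hp.heat_eq (hmem.toLp ρ)
  have hpos : ∀ n : ℕ, (0 : ℝ) < 1 / ((n : ℝ) + 1) := fun n => by positivity
  have ht : Tendsto (fun n : ℕ => 1 / ((n : ℝ) + 1)) atTop (𝓝[>] 0) :=
    tendsto_nhdsWithin_iff.2 ⟨tendsto_one_div_add_atTop_nhds_zero_nat, Eventually.of_forall hpos⟩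
  obtain ⟨ns, hns, hlim⟩ := (tendstoInMeasure_of_tendsto_Lp (hU0.comp ht)).exists_seq_tendsto_ae
  refine ⟨fun n => 1 / ((ns n : ℝ) + 1), fun n => hpos _,
    tendsto_one_div_add_atTop_nhds_zero_nat.comp hns.tendsto_atTop, ?_⟩
  filter_upwards [hlim, hmem.coeFn_toLp, ae_all_iff.2 fun n => hU _ (hpos n)] with x h1 h2 h3
  rw [h2] at h1
  refine h1.congr fun n => ?_
  rw [Function.comp_apply, h3, heatDensity_densityMeasure hρ.1 hρ.2.1]
  refine integral_congr_ae ?_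
  filter_upwards [hmem.coeFn_toLp] with y hy
  rw [hy]

end HeatKernel

end MassOpt

theorem proposition3p3 {d : ℕ} (D Γ₀ Γ₁ : Set (MassOpt.Euc d))
    (hDo : IsOpen D) (hDc : Convex ℝ D) (hDb : Bornology.IsBounded D) (hDn : D.Nonempty)
    (hΓ₀ : Γ₀ ⊆ frontier D) (hΓ₀m : MeasurableSet Γ₀)
    (hΓ₀pos : 0 < MassOpt.surfaceMeasure D Γ₀)
    (hΓ₁ : Γ₁ ⊆ frontier D) (hΓ₁m : MeasurableSet Γ₁) (hΓ₁n : Γ₁.Nonempty)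
    (hΓ : Disjoint Γ₀ Γ₁)
    (p : ℝ → MassOpt.Euc d → MassOpt.Euc d → ℝ) (hp : MassOpt.IsNeumannHeatKernel D p)
    (κ : ℝ → ℝ) (hκ : MassOpt.IsConductivity κ)
    (f : MassOpt.H1Zero D Γ₀ →L[ℝ] ℝ)
    (g : MassOpt.HHalf D Γ₁ →ₗ[ℝ] ℝ) (hg : MassOpt.IsHNegHalf g) :
    -- the functional `J` is well defined on `𝒟`
    (∀ ρ ∈ MassOpt.allDensities D p,
      ∃! u : MassOpt.H1Zero D Γ₀, MassOpt.IsWeakSolution κ f g ρ u) ∧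
    -- continuity of `J` along a.e. convergent sequences in `𝒟_δ`
    (∀ δ > 0, ∀ (ρ : ℕ → MassOpt.Euc d → ℝ) (ρ' : MassOpt.Euc d → ℝ),
      (∀ n, ρ n ∈ MassOpt.densityClass D p δ) → ρ' ∈ MassOpt.densityClass D p δ →
      (∀ᵐ x ∂volume.restrict D, Tendsto (fun n => ρ n x) atTop (𝓝 (ρ' x))) →
      Tendsto (fun n => MassOpt.compliance κ f g (ρ n)) atTop
        (𝓝 (MassOpt.compliance κ f g ρ'))) ∧
    -- minimizers of `J_δ` approximate the infimum of `J` over `𝒟`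
    (∀ μ : ℝ → Measure (MassOpt.Euc d),
      (∀ δ > 0, μ δ ∈ MassOpt.probMeasures D ∧
        IsMinOn (MassOpt.relaxedCompliance p κ f g δ) (MassOpt.probMeasures D) (μ δ)) →
      ∃ (s : ℕ → ℝ) (m : ℝ), (∀ k, 0 < s k) ∧ Tendsto s atTop (𝓝 0) ∧
        IsGLB (MassOpt.compliance κ f g '' MassOpt.allDensities D p) m ∧
        Tendsto (fun k => MassOpt.relaxedCompliance p κ f g (s k) (μ (s k))) atTop (𝓝 m)) := by
  refine ⟨?_, ?_, ?_⟩
  · rintro ρ ⟨δ, -, hρ⟩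
    exact MassOpt.existsUnique_isWeakSolution hDo hDc hDb hDn hΓ₀pos hκ f g hg hρ.1 hρ.2.1
  · intro δ _ ρ ρ' hρ hρ' hlim
    exact MassOpt.tendsto_compliance hDo hDc hDb hDn hΓ₀pos hκ f g hg (fun n => (hρ n).1)
      (fun n => (hρ n).2.1) hρ'.1 hρ'.2.1 hlim
  intro μ hμ
  set J := MassOpt.compliance κ f g with hJ
  have hclass : ∀ δ > 0, ∀ ν ∈ MassOpt.probMeasures D,
      MassOpt.heatDensity p δ ν ∈ MassOpt.densityClass D p δ := fun δ hδ ν hν =>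
    MassOpt.heatDensity_mem_densityClass hp hDo hDb hδ hν
  have hne : (J '' MassOpt.allDensities D p).Nonempty :=
    ⟨_, mem_image_of_mem J ⟨1, one_pos, hclass 1 one_pos _ (hμ 1 one_pos).1⟩⟩
  have hbdd : BddBelow (J '' MassOpt.allDensities D p) := by
    refine ⟨0, ?_⟩
    rintro _ ⟨ρ, ⟨δ, -, hρ⟩, rfl⟩
    exact MassOpt.compliance_nonneg hDo hDc hDb hDn hΓ₀pos hκ f g hg hρ.1 hρ.2.1
  obtain ⟨m, hm⟩ : ∃ m, m = sInf (J '' MassOpt.allDensities D p) := ⟨_, rfl⟩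
  have hglb : IsGLB (J '' MassOpt.allDensities D p) m := hm ▸ isGLB_csInf hne hbdd
  have hstep : ∀ k : ℕ, ∃ s : ℝ, 0 < s ∧ s < 1 / ((k : ℝ) + 1) ∧
      MassOpt.relaxedCompliance p κ f g s (μ s) < m + 1 / ((k : ℝ) + 1) := by
    intro k
    have hk : (0 : ℝ) < 1 / ((k : ℝ) + 1) := by positivity
    obtain ⟨_, ⟨ρ, ⟨δ, hδ, hρ⟩, rfl⟩, hlt⟩ : ∃ b ∈ J '' MassOpt.allDensities D p,
        b < m + 1 / ((k : ℝ) + 1) := by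
      rw [hm]
      exact exists_lt_of_csInf_lt hne (by linarith)
    have hprob := MassOpt.densityMeasure_mem_probMeasures hρ
    obtain ⟨t, ht0, ht, hlim⟩ := MassOpt.exists_seq_heatDensity_tendsto hp hDb hρ
    have hJlim : Tendsto (fun n => J (MassOpt.heatDensity p (t n) (MassOpt.densityMeasure D ρ)))
        atTop (𝓝 (J ρ)) :=
      MassOpt.tendsto_compliance hDo hDc hDb hDn hΓ₀pos hκ f g hg
        (fun n => (hclass _ (ht0 n) _ hprob).1) (fun n => (hclass _ (ht0 n) _ hprob).2.1)
        hρ.1 hρ.2.1 hlim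
    obtain ⟨n, hn1, hn2⟩ := ((hJlim.eventually_lt_const hlt).and (ht.eventually_lt_const hk)).exists
    exact ⟨t n, ht0 n, hn2, ((hμ (t n) (ht0 n)).2 hprob).trans_lt hn1⟩
  choose s hs0 hs1 hs2 using hstep
  have hlow : ∀ k, m ≤ MassOpt.relaxedCompliance p κ f g (s k) (μ (s k)) := fun k =>
    hglb.1 (mem_image_of_mem J ⟨s k, hs0 k, hclass _ (hs0 k) _ (hμ _ (hs0 k)).1⟩)
  refine ⟨s, m, hs0, ?_, hglb, ?_⟩
  · exact squeeze_zero (fun k => (hs0 k).le) (fun k => (hs1 k).le)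
      tendsto_one_div_add_atTop_nhds_zero_nat
  · have h := (tendsto_one_div_add_atTop_nhds_zero_nat (𝕜 := ℝ)).const_add m
    rw [add_zero] at h
    exact tendsto_of_tendsto_of_tendsto_of_le_of_le tendsto_const_nhds h hlow fun k => (hs2 k).le
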